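/- **Theorem (Equivalence of definitions).** Fix real numbers $m,\varepsilon>0$. *Finite-lattice propagator.* Let $T$ be a positive integer and $0<\delta<1$. The *lattice of size $T$* is the set of points $(x,t)$ with $2x/\varepsilon,\,2t/\varepsilon,\,(x+t)/\varepsilon\in\mathbb Z$, where $x$ and $t$ are taken modulo $T\varepsilon$. A lattice point is *even* if $2x/\varepsilon$ is even, and *odd* otherwise. An *edge* is a vector from a lattice point $(x,t)$ to $(x-\frac\varepsilon2,t+\frac\varepsilon2)$ or to $(x+\frac\varepsilon2,t+\frac\varepsilon2)$. A *path* is a finite nonempty sequence of distinct edges such that the endpoint of each edge is the starting point of the next one. A *loop* is a cyclic sequence of at least two distinct edges with the same property, considered up to the choice of the starting edge. A *node* of a path or loop $s$ is an ordered pair of consecutive edges of $s$ (for a loop, cyclically consecutive); it is a *turn* if the two edges are orthogonal; a node or turn is even or odd according to the common point of the two edges. The *arrow* of $s$ is $$ A(s)=\pm\frac{(-im\varepsilon)^{\mathrm{oddturns}(s)}(-\delta)^{\mathrm{eventurns}(s)}}{(1+m^2\varepsilon^2)^{\mathrm{oddnodes}(s)/2}(1-\delta^2)^{\mathrm{evennodes}(s)/2}},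 $$ where the exponents are the numbers of odd and even turns and nodes of $s$, and the minus sign is taken if and only if $s$ is a loop. A *loop configuration* is a set of loops, no two of which have a common edge. A *loop configuration with source $a$ and sink $f$* consists of a set of loops and exactly one path starting with the edge $a$ and ending with the edge $f$, such that no two of these loops and path have a common edge. The arrow $A(S)$ of a configuration $S$ is the product of the arrows of its loops and path (an empty product is $1$). Set $$ A(a\to f)=A(a\to f;m,\varepsilon,\delta,T):=\frac{\sum_{S\text{ with source }a\text{ and sink }f}A(S)}{\sum_{S}A(S)}, $$ the sum in the denominator being over all loop configurations (without source and sink). For $(x,t)\in\varepsilon\mathbb Z^2$ let $a_0$, $f_1(x,t)$, $f_2(x,t)$ be the edges of the torus from $(0,0)$ to $(\frac\varepsilon2,\frac\varepsilon2)$, from $(x,t)$ to $(x-\frac\varepsilon2,t+\frac\varepsilon2)$, and from $(x,t)$ to $(x+\frac\varepsilon2,t+\frac\varepsilon2)$ respectively (coordinates modulo $T\varepsilon$). *Axiomatic propagator.* For $0<\delta<1$ consider pairs of complex-valued functions $A_1,A_2$ on $\{(x,t)\in\mathbb R^2: 2x/\varepsilon,\,2t/\varepsilon,\,(x+t)/\varepsilon\in\mathbb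 Z\}$ such that 1. for each $(x,t)$ with $2x/\varepsilon$ and $2t/\varepsilon$ even, $$A_1(x,t)=\tfrac{1}{\sqrt{1+m^2\varepsilon^2}}\left(A_1(x+\tfrac\varepsilon2,t-\tfrac\varepsilon2)+m\varepsilon A_2(x+\tfrac\varepsilon2,t-\tfrac\varepsilon2)\right),$$ $$A_2(x,t)=\tfrac{1}{\sqrt{1+m^2\varepsilon^2}}\left(A_2(x-\tfrac\varepsilon2,t-\tfrac\varepsilon2)-m\varepsilon A_1(x-\tfrac\varepsilon2,t-\tfrac\varepsilon2)\right)+2\delta_{x0}\delta_{t0},$$ where $\delta_{x0},\delta_{t0}$ are Kronecker deltas; 2. for each $(x,t)$ with $2x/\varepsilon$ and $2t/\varepsilon$ odd, $$A_1(x,t)=\tfrac{1}{\sqrt{1-\delta^2}}\left(A_1(x+\tfrac\varepsilon2,t-\tfrac\varepsilon2)-i\delta A_2(x+\tfrac\varepsilon2,t-\tfrac\varepsilon2)\right),$$ $$A_2(x,t)=\tfrac{1}{\sqrt{1-\delta^2}}\left(A_2(x-\tfrac\varepsilon2,t-\tfrac\varepsilon2)+i\delta A_1(x-\tfrac\varepsilon2,t-\tfrac\varepsilon2)\right);$$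 3. $\sum_{(x,t)\in\varepsilon\mathbb Z^2}\left(|A_1(x,t)|^2+|A_2(x,t)|^2\right)<\infty$. Then: - for each integer $T\ge1$ and each $0<\delta<1$, the denominator $\sum_S A(S)$ of the finite-lattice propagator is nonzero; - for each $0<\delta<1$ there is exactly one pair $A_k(x,t)=A_k(x,t,m,\varepsilon,\delta)$, $k\in\{1,2\}$, satisfying 1–3, and the limit $\widetilde A_k(x,t,m,\varepsilon):=\lim_{\delta\searrow0}A_k(x,t,m,\varepsilon,\delta)$ exists for each $k\in\{1,2\}$ and $(x,t)\in\varepsilon\mathbb Z^2$; - for each $k\in\{1,2\}$ and $(x,t)\in\varepsilon\mathbb Z^2$, the limit $\lim_{T\to\infty}A(a_0\to f_k(x,t);m,\varepsilon,\delta,T)$ exists for each $0<\delta<1$, and the iterated limit below exists and satisfies $$-2(-i)^k\lim_{\delta\searrow0}\,\lim_{T\to\infty}A(a_0\to f_k(x,t);m,\varepsilon,\delta,T)=\widetilde A_k(x,t,m,\varepsilon).$$ -/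

import Mathlib

open Filter Topology

namespace FeynmanAnticheckers

/-! ### Lattice points and edges

A point `(x, t)` of the plane with `2x/ε`, `2t/ε`, `(x+t)/ε` integers is represented by its pair of
coordinates `(2x/ε, 2t/ε)` measured in half-steps `ε/2`. For the infinite lattice the coordinates
are taken in `ℤ`, for the torus of size `T` (where `x` and `t` are read modulo `Tε`) they are taken
in `ZMod (2 * T)`. The condition that `(x+t)/ε` is an integer says that the sum is even. -/

/-- Lattice points, with coordinates (in half-steps) in `R = ℤ` or `R = ZMod (2 * T)`. -/
abbrev Site (R : Type) [CommRing R] : Type := {p : R × R // Even (p.1 + p.2)}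

/-- The two directions of edges: `left` is `(-ε/2, ε/2)` and `right` is `(ε/2, ε/2)`. -/
inductive Dir : Type
  | left
  | right
  deriving DecidableEq

instance : Fintype Dir := ⟨{.left, .right}, by intro d; cases d <;> simp⟩

/-- The index `k ∈ {1, 2}` attached to a direction: `1` for upwards-left, `2` for upwards-right. -/
def Dir.index : Dir → ℕ
  | .left => 1
  | .right => 2

section Lattice

variable {R : Type} [CommRing R]

/-- A lattice point `(x, t)` is even if `2x/ε` is even, and odd otherwise. -/
def Site.IsEven (p : Site R) : Prop := Even p.1.1

/-- The point `(nε, jε)` (its image in the torus, if `R = ZMod (2 * T)`). -/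
def evenSite (R : Type) [CommRing R] (n j : ℤ) : Site R :=
  ⟨(2 * (n : R), 2 * (j : R)), ⟨(n : R) + j, by ring⟩⟩

/-- The point reached from `p` by one edge of direction `d`. -/
def Site.next (d : Dir) (p : Site R) : Site R :=
  match d with
  | .left => ⟨(p.1.1 - 1, p.1.2 + 1), by
      have h : p.1.1 - 1 + (p.1.2 + 1) = p.1.1 + p.1.2 := by ring
      simpa only [h] using p.2⟩
  | .right => ⟨(p.1.1 + 1, p.1.2 + 1), by
      have h : p.1.1 + 1 + (p.1.2 + 1) = p.1.1 + p.1.2 + (1 + 1) := by ring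
      simpa only [h] using p.2.add ⟨1, rfl⟩⟩

/-- The point from which one edge of direction `d` leads to `p`: for `p = (x, t)` it is
`(x + ε/2, t - ε/2)` if `d` is `left` and `(x - ε/2, t - ε/2)` if `d` is `right`. -/
def Site.prev (d : Dir) (p : Site R) : Site R :=
  match d with
  | .left => ⟨(p.1.1 + 1, p.1.2 - 1), by
      have h : p.1.1 + 1 + (p.1.2 - 1) = p.1.1 + p.1.2 := by ring
      simpa only [h] using p.2⟩
  | .right => ⟨(p.1.1 - 1, p.1.2 - 1), by
      have h : p.1.1 - 1 + (p.1.2 - 1) = p.1.1 + p.1.2 - (1 + 1) := by ring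
      simpa only [h] using p.2.sub ⟨1, rfl⟩⟩

/-- An edge, given by its starting point and its direction. -/
abbrev Edge (R : Type) [CommRing R] : Type := Site R × Dir

/-- The endpoint of an edge. -/
def Edge.target (e : Edge R) : Site R := e.1.next e.2

/-- `f` can follow `e`: the endpoint of `e` is the starting point of `f`. -/
def Follows (e f : Edge R) : Prop := Edge.target e = f.1

/-! ### Nodes, turns and arrows -/

/-- The nodes of a sequence of edges `e₁ e₂ … eₙ`: the pairs `(e₁, e₂), …, (eₙ₋₁, eₙ)`. -/
def pathNodes (s : List (Edge R)) : Multiset (Edge R × Edge R) := (s.zip s.tail : List _)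

/-- The nodes of a cyclic sequence `e₁ e₂ … eₙ e₁` considered up to the change of the starting
edge: the pairs `(e₁, e₂), …, (eₙ₋₁, eₙ), (eₙ, e₁)`. -/
def loopNodes (s : Cycle (Edge R)) : Multiset (Edge R × Edge R) :=
  Quotient.liftOn s (fun l => ((l.zip (l.rotate 1) : List _) : Multiset (Edge R × Edge R))) (by
    rintro l _ ⟨n, rfl⟩
    refine Multiset.coe_eq_coe.mpr ?_
    have h : (l.zip (l.rotate 1)).rotate n = (l.rotate n).zip ((l.rotate n).rotate 1) := by
      rw [List.rotate_rotate, Nat.add_comm n 1, ← List.rotate_rotate]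
      exact List.zipWith_rotate_distrib Prod.mk l (l.rotate 1) n (by simp)
    rw [← h]
    exact (List.rotate_perm _ n).symm)

open Classical in
/-- Number of odd turns: the edges are orthogonal and meet at an odd point. -/
noncomputable def oddTurns (N : Multiset (Edge R × Edge R)) : ℕ :=
  N.countP fun q => ¬ (Edge.target q.1).IsEven ∧ q.1.2 ≠ q.2.2

open Classical in
/-- Number of even turns. -/
noncomputable def evenTurns (N : Multiset (Edge R × Edge R)) : ℕ :=
  N.countP fun q => (Edge.target q.1).IsEven ∧ q.1.2 ≠ q.2.2

open Classical in
/-- Number of odd nodes. -/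
noncomputable def oddNodes (N : Multiset (Edge R × Edge R)) : ℕ :=
  N.countP fun q => ¬ (Edge.target q.1).IsEven

open Classical in
/-- Number of even nodes. -/
noncomputable def evenNodes (N : Multiset (Edge R × Edge R)) : ℕ :=
  N.countP fun q => (Edge.target q.1).IsEven

/-- The weight determined by a collection of nodes (without the overall sign). -/
noncomputable def nodeWeight (m ε δ : ℝ) (N : Multiset (Edge R × Edge R)) : ℂ :=
  ((-Complex.I * m * ε) ^ oddTurns N * (-(δ : ℂ)) ^ evenTurns N) /
    ((√(1 + m ^ 2 * ε ^ 2) : ℂ) ^ oddNodes N * (√(1 - δ ^ 2) : ℂ) ^ evenNodes N)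

end Lattice

/-! ### Paths, loops and loop configurations on the torus -/

/-- Edges of the lattice of size `T` on the torus. -/
abbrev TorusEdge (T : ℕ) : Type := Edge (ZMod (2 * T))

/-- A sequence of distinct edges, each starting at the endpoint of the previous one. -/
abbrev TorusPath (T : ℕ) : Type :=
  {s : List (TorusEdge T) // s.Nodup ∧ s.IsChain Follows}

/-- A loop: a cyclic sequence of at least two distinct edges, each starting at the endpoint of the
(cyclically) previous one, up to the change of the starting edge. -/
abbrev TorusLoop (T : ℕ) : Type :=
  {s : Cycle (TorusEdge T) // s.Nodup ∧ s.Nontrivial ∧ s.Chain Follows}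

section Torus

variable {T : ℕ}

instance [NeZero T] : Finite (TorusPath T) :=
  haveI : Fintype (TorusEdge T) := Fintype.ofFinite _
  haveI : DecidableEq (TorusEdge T) := Classical.decEq _
  Finite.of_injective (β := {s : List (TorusEdge T) // s.Nodup}) (fun s => ⟨s.1, s.2.1⟩)
    (fun _ _ h => Subtype.ext (Subtype.mk.inj h))

instance [NeZero T] : Finite (TorusLoop T) :=
  haveI : Fintype (TorusEdge T) := Fintype.ofFinite _
  haveI : DecidableEq (TorusEdge T) := Classical.decEq _
  Finite.of_injective (β := {s : Cycle (TorusEdge T) // s.Nodup}) (fun s => ⟨s.1, s.2.1⟩)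
    (fun _ _ h => Subtype.ext (Subtype.mk.inj h))

noncomputable instance [NeZero T] : Fintype (TorusPath T) := Fintype.ofFinite _

noncomputable instance [NeZero T] : Fintype (TorusLoop T) := Fintype.ofFinite _

/-- The arrow of a path. -/
noncomputable def pathArrow (m ε δ : ℝ) (s : TorusPath T) : ℂ :=
  nodeWeight m ε δ (pathNodes s.1)

/-- The arrow of a loop (with the overall minus sign). -/
noncomputable def loopArrow (m ε δ : ℝ) (s : TorusLoop T) : ℂ :=
  -nodeWeight m ε δ (loopNodes s.1)

/-- A loop configuration: a set of loops, no two of which have a common edge. -/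
def IsLoopConfig (S : Finset (TorusLoop T)) : Prop :=
  ∀ s ∈ S, ∀ s' ∈ S, s ≠ s' → ∀ e : TorusEdge T, ¬ (e ∈ s.1 ∧ e ∈ s'.1)

/-- A loop configuration with the source `a` and the sink `f`: a path from the edge `a` to the
edge `f` together with a set of loops, such that no two of them all have a common edge. -/
def IsLoopConfigFromTo (a f : TorusEdge T) (S : TorusPath T × Finset (TorusLoop T)) : Prop :=
  S.1.1.head? = some a ∧ S.1.1.getLast? = some f ∧ IsLoopConfig S.2 ∧
    ∀ s ∈ S.2, ∀ e : TorusEdge T, ¬ (e ∈ S.1.1 ∧ e ∈ s.1)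

open Classical in
/-- The denominator of the finite-lattice propagator: the sum of the arrows of all loop
configurations. -/
noncomputable def loopSum (T : ℕ) [NeZero T] (m ε δ : ℝ) : ℂ :=
  ∑ S : Finset (TorusLoop T) with IsLoopConfig S, ∏ s ∈ S, loopArrow m ε δ s

open Classical in
/-- The numerator of the finite-lattice propagator: the sum of the arrows of all loop
configurations with the source `a` and the sink `f`. -/
noncomputable def loopSumFromTo [NeZero T] (m ε δ : ℝ) (a f : TorusEdge T) : ℂ :=
  ∑ S : TorusPath T × Finset (TorusLoop T) with IsLoopConfigFromTo a f S,
    pathArrow m ε δ S.1 * ∏ s ∈ S.2, loopArrow m ε δ s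

/-- The finite-lattice propagator `A(a → f; m, ε, δ, T)`. -/
noncomputable def finitePropagator [NeZero T] (m ε δ : ℝ) (a f : TorusEdge T) : ℂ :=
  loopSumFromTo m ε δ a f / loopSum T m ε δ

/-- The edge `a₀` from `(0, 0)` to `(ε/2, ε/2)`. -/
def sourceEdge (T : ℕ) : TorusEdge T := (evenSite (ZMod (2 * T)) 0 0, .right)

/-- The edge `f_k(x, t)` for `(x, t) = (nε, jε)`: it starts at `(x mod Tε, t mod Tε)` and goes
upwards-left for `k = 1` and upwards-right for `k = 2`. -/
def sinkEdge (T : ℕ) (k : Dir) (n j : ℤ) : TorusEdge T := (evenSite (ZMod (2 * T)) n j, k)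

end Torus

/-! ### The axiomatic definition -/

open Classical in
/-- The three axioms for a pair of functions `A₁ = A .left`, `A₂ = A .right` on the infinite
lattice. -/
structure SatisfiesAxioms (m ε δ : ℝ) (A : Dir → Site ℤ → ℂ) : Prop where
  even_left : ∀ p : Site ℤ, p.IsEven →
    A .left p = 1 / (√(1 + m ^ 2 * ε ^ 2) : ℂ) *
      (A .left (p.prev .left) + m * ε * A .right (p.prev .left))
  even_right : ∀ p : Site ℤ, p.IsEven →
    A .right p = 1 / (√(1 + m ^ 2 * ε ^ 2) : ℂ) *
      (A .right (p.prev .right) - m * ε * A .left (p.prev .right)) +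
      if p = evenSite ℤ 0 0 then 2 else 0
  odd_left : ∀ p : Site ℤ, ¬ p.IsEven →
    A .left p = 1 / (√(1 - δ ^ 2) : ℂ) *
      (A .left (p.prev .left) - Complex.I * δ * A .right (p.prev .left))
  odd_right : ∀ p : Site ℤ, ¬ p.IsEven →
    A .right p = 1 / (√(1 - δ ^ 2) : ℂ) *
      (A .right (p.prev .right) + Complex.I * δ * A .left (p.prev .right))
  square_summable : Summable fun q : ℤ × ℤ =>
    ‖A .left (evenSite ℤ q.1 q.2)‖ ^ 2 + ‖A .right (evenSite ℤ q.1 q.2)‖ ^ 2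

/-- The pair of functions `A_k(·, ·, m, ε, δ)` satisfying the axioms. -/
noncomputable def axiomaticPropagator (m ε δ : ℝ) : Dir → Site ℤ → ℂ :=
  Classical.epsilon (SatisfiesAxioms m ε δ)

/-- The lattice propagator `Ã_k(x, t, m, ε)` at `(x, t) = (nε, jε)`: the limit of
`A_k(x, t, m, ε, δ)` as `δ ↘ 0`. -/
noncomputable def latticePropagator (m ε : ℝ) (k : Dir) (n j : ℤ) : ℂ :=
  limUnder (𝓝[>] (0 : ℝ)) fun δ => axiomaticPropagator m ε δ k (evenSite ℤ n j)

end FeynmanAnticheckers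

open FeynmanAnticheckers

namespace FeynmanAnticheckers

/-! ### Determinants as sums over collections of disjoint loops -/

section Loops

open Equiv.Perm

variable {E : Type} [DecidableEq E] {r : E → E → Prop}

/-! Both propagators solve nearly the same linear equation on the lattice, and that equation can be
solved uniquely and explicitly.

Combinatorics. Let $w$ be the matrix indexed by edges whose entry $(e,f)$ is the weight of the node
$(e,f)$, and 0 if $f$ does not follow $e$. In the Leibniz expansion of $\det(1-w)$ a permutation is
a set of disjoint cycles, and each cycle contributes minus the product of its weights; hence the
denominator is $\det(1-w)$ (`loopSum_eq_det`). Expanding a cofactor row by row from $a$ until $f$ is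
reached traces out the path, so the numerator is the entry $(a,f)$ of the adjugate
(`loopSumFromTo_eq_adjugate`). Once the determinant is nonzero, $g=A(a\to\cdot)$ satisfies
$g=gw+1_a$.

Energy estimate. Composing two steps gives an evolution on even points (`IsEvolution`). With
$\mu=m\varepsilon$ and $\kappa=\sqrt{1+\mu^2}\sqrt{1-\delta^2}$, its symbol divided by $\kappa$ has
determinant 1 and trace $2(\cos p+i\mu\delta)/\kappa$, so by Cayley–Hamilton each component $f$
satisfies $\kappa(f(n,j+1)+f(n,j-1))-f(n+1,j)-f(n-1,j)-2i\mu\delta f(n,j)=$ source. Multiplying by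
$\bar f$, taking imaginary parts and summing kills the difference terms and leaves
$2\mu\delta\|f\|\le\|\text{source}\|$ in $\ell^2$ (`sum_sq_le_of_scalar_equation`). On the torus
this gives a nonzero determinant and a bound uniform in $T$; on $\mathbb Z^2$ it gives uniqueness.
By compactness, the propagators then converge as $T\to\infty$ to the unique square-summable
solution.

Explicit solution. The scalar equation has a Green function given by a Fourier integral (`green`),
whose integrand stays continuous up to $\delta=0$ because $\kappa>1$ there. The two definitions
differ by a shift $y=\pm1$ occurring only in terms with a factor $\delta$, which vanish in the
limit. Replacing $A_1$ by $-iA_1$ and doubling the source accounts for the factor $-2(-i)^k$. -/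

theorem cycle_mem_toFinset (s : Cycle E) (e : E) : e ∈ s.toFinset ↔ e ∈ s := by
  induction s using Quotient.inductionOn
  simp [Cycle.toFinset]

variable (r) in
/-- Loops of a relation: cyclic sequences of at least two distinct related elements. -/
abbrev RelLoop : Type := {s : Cycle E // s.Nodup ∧ s.Nontrivial ∧ s.Chain r}

/-- The cyclic permutation that moves each element of a loop to the next one. -/
def RelLoop.perm (s : RelLoop r) : Equiv.Perm E := s.1.formPerm s.2.1

theorem RelLoop.isCycle_perm (s : RelLoop r) : s.perm.IsCycle :=
  Cycle.isCycle_formPerm s.1 s.2.1 s.2.2.1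

/-- Identifies the nodes of a loop with the graph of its cyclic permutation. -/
theorem zip_rotate_one_eq_map_formPerm (l : List E) (hl : l.Nodup) :
    l.zip (l.rotate 1) = l.map fun e => (e, l.formPerm e) := by
  refine List.ext_getElem (by simp) fun i h1 h2 => ?_
  have hi : i < l.length := by simpa using h2
  simp only [List.getElem_zip, List.getElem_map, List.getElem_rotate]
  rw [List.formPerm_apply_getElem l hl i hi]

theorem cycle_chain_iff (s : Cycle E) (hs : s.Nodup) :
    s.Chain r ↔ ∀ e ∈ s, r e (s.formPerm hs e) := by
  induction s using Cycle.induction_on with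
  | nil => simp
  | cons a l _ =>
    have hl : (a :: l).Nodup := hs
    rw [Cycle.chain_coe_cons, ← List.cons_append, List.isChain_cons_append_singleton_iff_forall₂,
      List.forall₂_iff_zip]
    have hz := zip_rotate_one_eq_map_formPerm (a :: l) hl
    rw [List.rotate_cons_succ, List.rotate_zero] at hz
    rw [hz]
    simp only [Cycle.mem_coe_iff]
    constructor
    · intro h e he
      exact h.2 (List.mem_map_of_mem (f := fun e => (e, (a :: l).formPerm e)) he)
    · intro h
      refine ⟨by simp, ?_⟩
      intro x y hxy
      obtain ⟨e, he, hxy⟩ := List.mem_map.mp hxy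
      obtain ⟨rfl, rfl⟩ := Prod.mk.inj hxy
      exact h _ he

variable [Fintype E]

/-- The product of the weights of the steps of a permutation on its support. -/
def cycleWeight (w : Matrix E E ℂ) (c : Equiv.Perm E) : ℂ := ∏ e ∈ c.support, w e (c e)

/-- Both sides are multiplicative over disjoint permutations, so a single cycle suffices. Fixed
points contribute the diagonal entry 1 because $w$ has zero diagonal. -/
theorem det_one_sub_eq_sum_cycleFactors (w : Matrix E E ℂ) (hw : ∀ e, w e e = 0) :
    (1 - w).det = ∑ σ : Equiv.Perm E, ∏ c ∈ σ.cycleFactorsFinset, -cycleWeight w c := by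
  -- The Leibniz formula uses the entries $(\sigma e,e)$; transposing turns them into steps from $e$
  -- to $\sigma e$.
  rw [← Matrix.det_transpose, Matrix.det_apply']
  refine Finset.sum_congr rfl fun σ _ => ?_
  simp only [Matrix.transpose_apply]
  have hfix : ∀ (τ : Equiv.Perm E) (e : E), τ e = e → (1 - w) e (τ e) = 1 := by
    intro τ e h
    simp [h, hw]
  clear * - hw hfix
  induction σ using cycle_induction_on with
  | base_one => simp [hw]
  | base_cycles σ hσ =>
    have h : ∏ e, (1 - w) e (σ e) = ∏ e ∈ σ.support, -w e (σ e) := by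
      rw [← Finset.prod_subset (Finset.subset_univ σ.support)
        (fun e _ he => hfix σ e (notMem_support.mp he))]
      refine Finset.prod_congr rfl fun e he => ?_
      have : e ≠ σ e := (mem_support.mp he).symm
      simp [this]
    rw [h, Finset.prod_neg, hσ.cycleFactorsFinset_eq_singleton, Finset.prod_singleton, hσ.sign,
      cycleWeight, ← mul_assoc]
    -- A cycle of length $n$ has sign $-(-1)^n$, and its $n$ off-diagonal entries $-w$ give another
    -- $(-1)^n$; one minus sign survives.
    push_cast
    rw [neg_mul, ← mul_pow]
    simp
  | induction_disjoint σ τ hd _ hσ hτ =>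
    rw [hd.cycleFactorsFinset_mul_eq_union,
      Finset.prod_union hd.disjoint_cycleFactorsFinset, ← hσ, ← hτ]
    have h : ∏ e, (1 - w) e ((σ * τ) e) = (∏ e, (1 - w) e (σ e)) * ∏ e, (1 - w) e (τ e) := by
      rw [← Finset.prod_mul_distrib]
      refine Finset.prod_congr rfl fun e _ => ?_
      rcases hd e with h | h
      · rw [hfix σ e h, one_mul]
        have h2 : σ (τ e) = τ e := by
          rcases hd (τ e) with h' | h'
          · exact h'
          · rw [τ.injective h', h]
        rw [mul_apply, h2]
      · rw [hfix τ e h, mul_one, mul_apply, h]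
    rw [h, Equiv.Perm.sign_mul]
    push_cast
    ring

theorem RelLoop.mem_support_perm (s : RelLoop r) (e : E) : e ∈ s.perm.support ↔ e ∈ s.1 := by
  have h := Cycle.support_formPerm s.1 s.2.1 s.2.2.1
  rw [RelLoop.perm, h, cycle_mem_toFinset]

/-- Nontrivial cyclic sequences without repetitions correspond bijectively to cyclic permutations
(`isoCycle`). -/
theorem RelLoop.perm_injective : Function.Injective (RelLoop.perm (r := r)) := by
  intro s t h
  have h1 : (isoCycle.symm ⟨s.1, s.2.1, s.2.2.1⟩) = isoCycle.symm ⟨t.1, t.2.1, t.2.2.1⟩ :=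
    Subtype.ext h
  have h2 := isoCycle.symm.injective h1
  exact Subtype.ext (Subtype.mk.inj h2)

theorem exists_relLoop_perm_eq (c : Equiv.Perm E) (hc : c.IsCycle)
    (hr : ∀ e ∈ c.support, r e (c e)) : ∃ s : RelLoop r, s.perm = c := by
  obtain ⟨s, hs⟩ := (isoCycle (α := E)).symm.surjective ⟨c, hc⟩
  have hs' : s.1.formPerm s.2.1 = c := congrArg Subtype.val hs
  refine ⟨⟨s.1, s.2.1, s.2.2, ?_⟩, hs'⟩
  rw [cycle_chain_iff s.1 s.2.1, hs']
  intro e he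
  refine hr e ?_
  rwa [← hs', Cycle.support_formPerm s.1 s.2.1 s.2.2, cycle_mem_toFinset]

/-- Sets of loops without common elements. -/
def DisjointLoops (S : Finset (RelLoop r)) : Prop :=
  ∀ s ∈ S, ∀ s' ∈ S, s ≠ s' → ∀ e : E, ¬ (e ∈ s.1 ∧ e ∈ s'.1)

theorem disjoint_perm_iff (s t : RelLoop r) :
    Disjoint s.perm t.perm ↔ ∀ e : E, ¬ (e ∈ s.1 ∧ e ∈ t.1) := by
  rw [disjoint_iff_disjoint_support, Finset.disjoint_left]
  simp only [RelLoop.mem_support_perm, not_and]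

open Classical in
theorem DisjointLoops.exists_perm {S : Finset (RelLoop r)} (hS : DisjointLoops S) :
    ∃ σ : Equiv.Perm E, σ.cycleFactorsFinset = S.image RelLoop.perm := by
  have hd : ((S.image RelLoop.perm : Finset (Equiv.Perm E)) : Set (Equiv.Perm E)).Pairwise
      Disjoint := by
    intro x hx y hy hxy
    simp only [Finset.coe_image, Set.mem_image, Finset.mem_coe] at hx hy
    obtain ⟨s, hs, rfl⟩ := hx
    obtain ⟨t, ht, rfl⟩ := hy
    exact (disjoint_perm_iff s t).mpr (hS s hs t ht fun h => hxy (by rw [h]))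
  refine ⟨_, cycleFactorsFinset_eq_finset.mpr ⟨?_, hd, rfl⟩⟩
  intro f hf
  obtain ⟨s, _, rfl⟩ := Finset.mem_image.mp hf
  exact s.isCycle_perm

-- A set of disjoint loops is the cycle decomposition of exactly one permutation. A permutation that
-- does not arise this way has a cycle with a step outside `r`, so its term is zero.
open Classical in
theorem sum_disjointLoops_eq_det [Fintype (RelLoop r)] (w : Matrix E E ℂ) (hw : ∀ e, w e e = 0)
    (hr : ∀ e f, ¬ r e f → w e f = 0) :
    ∑ S : Finset (RelLoop r) with DisjointLoops S, ∏ s ∈ S, -cycleWeight w s.perm =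
      (1 - w).det := by
  rw [det_one_sub_eq_sum_cycleFactors w hw]
  choose! F hF using fun (S : Finset (RelLoop r)) (hS : DisjointLoops S) => hS.exists_perm
  refine Finset.sum_of_injOn F ?_ (fun _ _ => Finset.mem_coe.mpr (Finset.mem_univ _)) ?_ ?_
  · intro S hS S' hS' h
    have hS := (Finset.mem_filter.mp hS).2
    have hS' := (Finset.mem_filter.mp hS').2
    have h2 : S.image RelLoop.perm = S'.image RelLoop.perm := by rw [← hF S hS, ← hF S' hS', h]
    exact Finset.image_injective RelLoop.perm_injective h2
  · intro σ _ hσ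
    by_contra hne
    refine hσ ?_
    rw [← ne_eq, Finset.prod_ne_zero_iff] at hne
    have hex : ∀ c ∈ σ.cycleFactorsFinset, ∃ s : RelLoop r, s.perm = c := by
      intro c hc
      have h1 := (mem_cycleFactorsFinset_iff.mp hc).1
      refine exists_relLoop_perm_eq c h1 fun e he => ?_
      by_contra hnr
      have h2 := hne c hc
      rw [neg_ne_zero, cycleWeight, Finset.prod_ne_zero_iff] at h2
      exact h2 e he (hr _ _ hnr)
    set S : Finset (RelLoop r) :=
      Finset.univ.filter fun s => s.perm ∈ σ.cycleFactorsFinset with hSdef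
    have hSσ : S.image RelLoop.perm = σ.cycleFactorsFinset := by
      ext c
      simp only [Finset.mem_image, hSdef, Finset.mem_filter, Finset.mem_univ, true_and]
      constructor
      · rintro ⟨s, hs, rfl⟩
        exact hs
      · intro hc
        obtain ⟨s, rfl⟩ := hex c hc
        exact ⟨s, hc, rfl⟩
    have hSd : DisjointLoops S := by
      intro s hs t ht hst
      rw [← disjoint_perm_iff]
      exact cycleFactorsFinset_pairwise_disjoint σ (Finset.mem_filter.mp hs).2
        (Finset.mem_filter.mp ht).2 fun h => hst (RelLoop.perm_injective h)
    refine ⟨S, by simpa using hSd, ?_⟩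
    exact cycleFactorsFinset_injective ((hF S hSd).trans hSσ)
  · intro S hS
    have hS := (Finset.mem_filter.mp hS).2
    rw [hF S hS, Finset.prod_image fun s _ t _ h => RelLoop.perm_injective h]

end Loops

/-! ### Minors as sums over paths -/

section Paths

variable {E : Type}

/-- The product of the weights of the steps of a list. -/
def listWeight (w : Matrix E E ℂ) (l : List E) : ℂ :=
  ((l.zip l.tail).map fun q => w q.1 q.2).prod

theorem listWeight_singleton (w : Matrix E E ℂ) (a : E) : listWeight w [a] = 1 := by
  simp [listWeight]

theorem listWeight_cons_cons (w : Matrix E E ℂ) (a b : E) (l : List E) :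
    listWeight w (a :: b :: l) = w a b * listWeight w (b :: l) := by
  simp [listWeight]

variable [DecidableEq E]

/-- The matrix `w` with the rows from `X` replaced by zero. -/
def eraseRows (w : Matrix E E ℂ) (X : Finset E) : Matrix E E ℂ :=
  fun e f => if e ∈ X then 0 else w e f

/-- `l` is a list of distinct elements from `a` to `f` that avoids `X`. -/
def IsListFromTo (X : Finset E) (a f : E) (l : List E) : Prop :=
  l.head? = some a ∧ l.getLast? = some f ∧ ∀ e ∈ l, e ∉ X

variable [Fintype E]

/-- One step of the path. Row $a$ is expanded over its possible successors $b$, and exchanging rows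
$a$ and $f$ puts a standard row at $a$ (so $a$ becomes forbidden) and moves the marker $e_b$ to row
$f$. -/
theorem det_updateRow_single_eq_sum (w : Matrix E E ℂ) (X : Finset E) {a f : E} (haf : a ≠ f)
    (ha : a ∉ X) :
    ((1 - eraseRows w X).updateRow f (Pi.single a 1)).det =
      ∑ b, w a b * ((1 - eraseRows w (insert a X)).updateRow f (Pi.single b 1)).det := by
  set M := 1 - eraseRows w X with hM
  have hrow : M a = Pi.single a 1 - ∑ b, w a b • (Pi.single b 1 : E → ℂ) := by
    ext e
    simp [hM, eraseRows, ha, Matrix.one_apply, Pi.single_apply, eq_comm]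
  have hN : M.updateRow f (Pi.single a 1) =
      (M.updateRow f (Pi.single a 1)).updateRow a (M a) := by
    ext i j
    by_cases hi : i = a
    · subst hi
      simp [Matrix.updateRow_apply, haf]
    · simp [Matrix.updateRow_apply, hi]
  rw [hN, hrow]
  have hsub : ∀ (N : Matrix E E ℂ) (v u : E → ℂ), (N.updateRow a (v - u)).det =
      (N.updateRow a v).det - (N.updateRow a u).det := by
    intro N v u
    have h1 := Matrix.det_updateRow_add N a v (-u)
    have h2 := Matrix.det_updateRow_smul N a (-1) u
    simp only [neg_smul, one_smul, neg_mul, one_mul] at h2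
    rw [sub_eq_add_neg, h1, h2, ← sub_eq_add_neg]
  rw [hsub]
  -- The diagonal part of row $a$ drops out: row $f$ is also $e_a$.
  have h0 : ((M.updateRow f (Pi.single a 1)).updateRow a (Pi.single a 1)).det = 0 := by
    refine Matrix.det_zero_of_row_eq haf ?_
    rw [Matrix.updateRow_self, Matrix.updateRow_ne haf.symm, Matrix.updateRow_self]
  rw [h0, zero_sub]
  have hsum : ((M.updateRow f (Pi.single a 1)).updateRow a
      (∑ b, w a b • (Pi.single b 1 : E → ℂ))).det =
      ∑ b, w a b * ((M.updateRow f (Pi.single a 1)).updateRow a (Pi.single b 1)).det := by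
    have h := (Matrix.detRowAlternating (R := ℂ) (n := E)).map_update_sum Finset.univ a
      (fun b => w a b • (Pi.single b 1 : E → ℂ)) (M.updateRow f (Pi.single a 1))
    refine h.trans (Finset.sum_congr rfl fun b _ => ?_)
    exact Matrix.det_updateRow_smul _ a _ _
  rw [hsum, ← Finset.sum_neg_distrib]
  refine Finset.sum_congr rfl fun b _ => ?_
  rw [← mul_neg]
  congr 1
  -- The sign of this transposition cancels the minus sign of $-w$ in row $a$.
  have hsw := Matrix.det_permute (Equiv.swap a f)
    ((M.updateRow f (Pi.single a 1)).updateRow a (Pi.single b 1))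
  rw [Equiv.Perm.sign_swap haf] at hsw
  have hsw' : -((M.updateRow f (Pi.single a 1)).updateRow a (Pi.single b 1)).det =
      (((M.updateRow f (Pi.single a 1)).updateRow a (Pi.single b 1)).submatrix
        (Equiv.swap a f) id).det := by
    rw [hsw]; simp
  rw [hsw']
  congr 1
  ext i j
  simp only [Matrix.submatrix_apply, id_eq, Matrix.updateRow_apply]
  by_cases hia : i = a
  · subst hia
    simp [haf, haf.symm, Matrix.one_apply, eraseRows, Pi.single_apply, eq_comm]
  · by_cases hif : i = f
    · subst hif
      simp
    · rw [Equiv.swap_apply_of_ne_of_ne hia hif]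
      simp [hia, hif, hM, eraseRows]

-- Induction on the number of vertices not yet forbidden. When the marker reaches $f$, row $f$
-- becomes the standard row $e_f$, and what remains is the determinant with all rows of the path
-- erased.
open Classical in
theorem det_updateRow_single_eq_sum_paths (w : Matrix E E ℂ) (f : E) (n : ℕ) :
    ∀ (X : Finset E) (a : E), Xᶜ.card = n → a ∉ X → f ∉ X →
    ((1 - eraseRows w X).updateRow f (Pi.single a 1)).det =
      ∑ l : {l : List E // l.Nodup} with IsListFromTo X a f l.1,
        listWeight w l.1 * (1 - eraseRows w (X ∪ l.1.toFinset)).det := by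
  induction n with
  | zero =>
    intro X a hX ha
    rw [Finset.card_eq_zero, Finset.compl_eq_empty_iff] at hX
    exact absurd (hX ▸ Finset.mem_univ a) ha
  | succ n ih =>
    intro X a hX ha hf
    by_cases haf : a = f
    · subst haf
      have hset : (Finset.univ.filter fun l : {l : List E // l.Nodup} => IsListFromTo X a a l.1) =
          {⟨[a], List.nodup_singleton a⟩} := by
        ext ⟨l, hl⟩
        simp only [Finset.mem_filter, Finset.mem_univ, true_and, Finset.mem_singleton,
          Subtype.mk.injEq]
        constructor
        · rintro ⟨h1, h2, -⟩
          cases l with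
          | nil => simp at h1
          | cons b t =>
            obtain rfl : b = a := by simpa using h1
            cases t with
            | nil => rfl
            | cons c t =>
              exfalso
              have : b ∈ c :: t := by
                rw [List.getLast?_cons_cons] at h2
                exact List.mem_of_getLast? h2
              exact (List.nodup_cons.mp hl).1 this
        · rintro rfl
          simp [IsListFromTo, ha]
      rw [hset, Finset.sum_singleton, listWeight_singleton, one_mul]
      congr 1
      ext i j
      by_cases hi : i = a
      · subst hi
        simp [Matrix.one_apply, eraseRows, Pi.single_apply, eq_comm]
      · simp [Matrix.updateRow_apply, hi, eraseRows]
    · rw [det_updateRow_single_eq_sum w X haf ha]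
      have hfX : f ∉ insert a X := by simp [Ne.symm haf, hf]
      have hcard : (insert a X)ᶜ.card = n := by
        rw [Finset.compl_insert, Finset.card_erase_of_mem (by simpa using ha), hX]
        rfl
      have hterm : ∀ b, ((1 - eraseRows w (insert a X)).updateRow f (Pi.single b 1)).det =
          ∑ l : {l : List E // l.Nodup} with IsListFromTo (insert a X) b f l.1,
            listWeight w l.1 * (1 - eraseRows w (insert a X ∪ l.1.toFinset)).det := by
        intro b
        -- A forbidden $b$ gives two equal rows $e_b$, so self-intersecting paths cancel
        -- automatically.
        by_cases hb : b ∈ insert a X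
        · have hbf : b ≠ f := fun h => hfX (h ▸ hb)
          rw [Finset.sum_eq_zero]
          · refine Matrix.det_zero_of_row_eq hbf ?_
            rw [Matrix.updateRow_self, Matrix.updateRow_ne hbf]
            ext j
            simp [eraseRows, hb, -Finset.mem_insert, Matrix.one_apply, Pi.single_apply, eq_comm]
          · rintro ⟨l, hl⟩ h
            obtain ⟨h1, -, h3⟩ := (Finset.mem_filter.mp h).2
            exact absurd hb (h3 b (List.mem_of_mem_head? (by simp [h1])))
        · exact ih _ _ hcard hb hfX
      simp_rw [hterm, Finset.mul_sum]
      rw [Finset.sum_sigma']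
      refine Finset.sum_bij'
        (fun p hp => ⟨a :: p.2.1, List.nodup_cons.mpr ⟨fun h => ?_, p.2.2⟩⟩)
        -- The default `a` is never attained: since $a\ne f$, a list from $a$ to $f$ has a second
        -- element.
        (fun l hl => ⟨l.1.tail.head?.getD a, l.1.tail, l.2.tail⟩) ?_ ?_ ?_ ?_ ?_
      · simp only [Finset.mem_sigma, Finset.mem_univ, Finset.mem_filter, true_and] at hp
        exact hp.2.2 a h (Finset.mem_insert_self a X)
      · rintro ⟨b, l, hl⟩ hp
        simp only [Finset.mem_sigma, Finset.mem_univ, Finset.mem_filter, true_and] at hp ⊢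
        obtain ⟨h1, h2, h3⟩ := hp
        refine ⟨by simp, ?_, ?_⟩
        · cases l with
          | nil => simp at h1
          | cons c t => rw [List.getLast?_cons_cons]; exact h2
        · intro e he
          rcases List.mem_cons.mp he with rfl | he
          · exact ha
          · exact fun h => h3 e he (Finset.mem_insert_of_mem h)
      · rintro ⟨l, hl⟩ hp
        simp only [Finset.mem_sigma, Finset.mem_univ, Finset.mem_filter, true_and] at hp ⊢
        obtain ⟨h1, h2, h3⟩ := hp
        cases l with
        | nil => simp at h1
        | cons b t =>
          obtain rfl : b = a := by simpa using h1
          cases t with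
          | nil => simp at h2; exact absurd h2 haf
          | cons c t =>
            refine ⟨by simp, ?_, ?_⟩
            · rw [List.getLast?_cons_cons] at h2; exact h2
            · intro e he h
              rcases Finset.mem_insert.mp h with rfl | h
              · exact (List.nodup_cons.mp hl).1 he
              · exact h3 e (List.mem_cons_of_mem _ he) h
      · rintro ⟨b, l, hl⟩ hp
        simp only [Finset.mem_sigma, Finset.mem_univ, Finset.mem_filter, true_and] at hp
        simp [hp.1]
      · rintro ⟨l, hl⟩ hp
        simp only [Finset.mem_univ, Finset.mem_filter, true_and] at hp
        obtain ⟨h1, h2, h3⟩ := hp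
        cases l with
        | nil => simp at h1
        | cons b t =>
          obtain rfl : b = a := by simpa using h1
          rfl
      · rintro ⟨b, l, hl⟩ hp
        simp only [Finset.mem_sigma, Finset.mem_univ, Finset.mem_filter, true_and] at hp
        cases l with
        | nil => simp [IsListFromTo] at hp
        | cons c t =>
          obtain rfl : c = b := by simpa using hp.1
          rw [listWeight_cons_cons, mul_assoc]
          have hset : insert a X ∪ (c :: t).toFinset = X ∪ (a :: c :: t).toFinset := by
            ext e
            simp only [Finset.mem_union, Finset.mem_insert, List.mem_toFinset, List.mem_cons]
            tauto
          rw [hset]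

end Paths

/-! ### The finite-lattice propagator as an entry of an inverse matrix -/

section Nodes

variable {R : Type} [CommRing R]

open Classical in
/-- The weight of a single node. -/
noncomputable def stepWeight (m ε δ : ℝ) (q : Edge R × Edge R) : ℂ :=
  (if q.1.2 ≠ q.2.2 then (if (Edge.target q.1).IsEven then -(δ : ℂ) else -Complex.I * m * ε)
    else 1) / (if (Edge.target q.1).IsEven then (√(1 - δ ^ 2) : ℂ) else (√(1 + m ^ 2 * ε ^ 2) : ℂ))

theorem nodeWeight_eq_prod (m ε δ : ℝ) (N : Multiset (Edge R × Edge R)) :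
    nodeWeight m ε δ N = (N.map (stepWeight m ε δ)).prod := by
  classical
  induction N using Multiset.induction_on with
  | empty => simp [nodeWeight, oddTurns, evenTurns, oddNodes, evenNodes]
  | cons q N ih =>
    rw [Multiset.map_cons, Multiset.prod_cons, ← ih]
    simp only [nodeWeight, oddTurns, evenTurns, oddNodes, evenNodes, Multiset.countP_cons,
      stepWeight]
    by_cases h1 : (Edge.target q.1).IsEven <;> by_cases h2 : q.1.2 = q.2.2
    · simp only [h1, h2, not_true_eq_false, ne_eq, and_self, if_true, if_false, add_zero, pow_succ]
      simp only [and_false, if_false, add_zero, div_eq_mul_inv, mul_inv]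
      ring
    · simp only [h1, h2, not_true_eq_false, not_false_eq_true, ne_eq, and_self, if_true, if_false,
        add_zero, pow_succ]
      simp only [false_and, if_false, add_zero, div_eq_mul_inv, mul_inv]
      ring
    · simp only [h1, h2, not_true_eq_false, not_false_eq_true, ne_eq, and_self, if_true, if_false,
        add_zero, pow_succ]
      simp only [and_false, if_false, add_zero, div_eq_mul_inv, mul_inv]
      ring
    · simp only [h1, h2, not_false_eq_true, ne_eq, and_self, if_true, if_false, add_zero,
        pow_succ]
      simp only [false_and, if_false, add_zero, div_eq_mul_inv, mul_inv]
      ring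

open Classical in
/-- The matrix of the weights of all the nodes. -/
noncomputable def hopMatrix (R : Type) [CommRing R] (m ε δ : ℝ) : Matrix (Edge R) (Edge R) ℂ :=
  fun e f => if Follows e f then stepWeight m ε δ (e, f) else 0

theorem hopMatrix_eq_zero (m ε δ : ℝ) {e f : Edge R} (h : ¬ Follows e f) :
    hopMatrix R m ε δ e f = 0 := if_neg h

theorem hopMatrix_eq (m ε δ : ℝ) {e f : Edge R} (h : Follows e f) :
    hopMatrix R m ε δ e f = stepWeight m ε δ (e, f) := if_pos h

theorem listWeight_hopMatrix_of_isChain (m ε δ : ℝ) (l : List (Edge R)) (hl : l.IsChain Follows) :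
    listWeight (hopMatrix R m ε δ) l = nodeWeight m ε δ (pathNodes l) := by
  rw [nodeWeight_eq_prod, pathNodes, Multiset.map_coe, Multiset.prod_coe]
  induction l with
  | nil => simp [listWeight]
  | cons a t ih =>
    cases t with
    | nil => simp [listWeight]
    | cons b t =>
      rw [List.isChain_cons_cons] at hl
      rw [listWeight_cons_cons, ih hl.2, hopMatrix_eq m ε δ hl.1]
      simp

theorem isChain_of_listWeight_hopMatrix_ne_zero (m ε δ : ℝ) (l : List (Edge R))
    (hl : listWeight (hopMatrix R m ε δ) l ≠ 0) : l.IsChain Follows := by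
  induction l with
  | nil => simp
  | cons a t ih =>
    cases t with
    | nil => simp
    | cons b t =>
      rw [listWeight_cons_cons] at hl
      rw [List.isChain_cons_cons]
      refine ⟨?_, ih (right_ne_zero_of_mul hl)⟩
      by_contra h
      exact left_ne_zero_of_mul hl (hopMatrix_eq_zero m ε δ h)

end Nodes

section TorusSums

variable {T : ℕ} [NeZero T]

noncomputable instance : Fintype (TorusEdge T) := Fintype.ofFinite _

instance : Nontrivial (ZMod (2 * T)) :=
  ZMod.nontrivial_iff.mpr (by have := NeZero.ne T; omega)

/-- An edge raises the time coordinate by 1, which is nonzero modulo $2T$. This matches the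
requirement that a loop have at least two edges. -/
theorem hopMatrix_self (m ε δ : ℝ) (e : TorusEdge T) : hopMatrix (ZMod (2 * T)) m ε δ e e = 0 := by
  refine hopMatrix_eq_zero m ε δ fun h => ?_
  have h2 := congrArg (fun p : Site (ZMod (2 * T)) => p.1.2) h
  rcases e with ⟨p, d⟩
  cases d <;> simp [Edge.target, Site.next] at h2

open Classical in
theorem loopArrow_eq (m ε δ : ℝ) (s : TorusLoop T) :
    loopArrow m ε δ s =
      -cycleWeight (hopMatrix (ZMod (2 * T)) m ε δ) (RelLoop.perm (r := Follows) s) := by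
  rw [loopArrow, nodeWeight_eq_prod, cycleWeight]
  congr 1
  have hc := (cycle_chain_iff s.1 s.2.1).mp s.2.2.2
  have h1 : ∀ e ∈ (RelLoop.perm (r := Follows) s).support,
      hopMatrix (ZMod (2 * T)) m ε δ e (RelLoop.perm (r := Follows) s e) =
        stepWeight m ε δ (e, RelLoop.perm (r := Follows) s e) := fun e he =>
    hopMatrix_eq m ε δ (hc e ((RelLoop.mem_support_perm (r := Follows) s e).mp he))
  rw [Finset.prod_congr rfl h1]
  clear h1 hc
  obtain ⟨s, hs, hn, hc⟩ := s
  simp only [RelLoop.perm]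
  rw [Cycle.support_formPerm s hs hn]
  induction s using Quotient.inductionOn with
  | h l =>
    have hl : l.Nodup := hs
    have hz := zip_rotate_one_eq_map_formPerm l hl
    change (Multiset.map _ (↑(l.zip (l.rotate 1)) : Multiset (TorusEdge T × TorusEdge T))).prod =
      ∏ e ∈ l.toFinset, stepWeight m ε δ (e, l.formPerm e)
    rw [hz, List.prod_toFinset _ hl, Multiset.map_coe, Multiset.prod_coe, List.map_map]
    rfl

theorem loopSum_eq_det (m ε δ : ℝ) :
    loopSum T m ε δ = (1 - hopMatrix (ZMod (2 * T)) m ε δ).det := by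
  classical
  rw [← sum_disjointLoops_eq_det (r := Follows) _ (hopMatrix_self m ε δ)
    (fun _ _ => hopMatrix_eq_zero m ε δ), loopSum]
  refine Finset.sum_congr ?_ fun S _ => Finset.prod_congr rfl fun s _ => ?_
  · ext S
    simp only [Finset.mem_filter, Finset.mem_univ, true_and]
    exact Iff.rfl
  · rw [loopArrow_eq]

theorem eraseRows_empty {E : Type} [DecidableEq E] (w : Matrix E E ℂ) : eraseRows w ∅ = w := by
  ext
  simp [eraseRows]

-- Erasing the rows in $X$ gives weight zero to every loop meeting $X$ and leaves the other loops
-- unchanged.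
open Classical in
theorem sum_disjointLoops_avoiding_eq_det {E : Type} [Fintype E] [DecidableEq E]
    {r : E → E → Prop} [Fintype (RelLoop r)] (w : Matrix E E ℂ)
    (hw : ∀ e, w e e = 0) (hr : ∀ e f, ¬ r e f → w e f = 0) (X : Finset E) :
    ∑ S : Finset (RelLoop r) with DisjointLoops S ∧ ∀ s ∈ S, ∀ e ∈ X, e ∉ s.1,
      ∏ s ∈ S, -cycleWeight w s.perm = (1 - eraseRows w X).det := by
  rw [← sum_disjointLoops_eq_det (r := r) (eraseRows w X) (fun e => by simp [eraseRows, hw])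
    (fun e f h => by simp [eraseRows, hr e f h]), ← Finset.filter_filter, Finset.sum_filter]
  refine Finset.sum_congr rfl fun S _ => ?_
  split_ifs with h
  · refine Finset.prod_congr rfl fun s hs => ?_
    congr 1
    refine Finset.prod_congr rfl fun e he => ?_
    have : e ∉ X := fun hX => h s hs e hX ((RelLoop.mem_support_perm s e).mp he)
    simp [eraseRows, this]
  · push Not at h
    obtain ⟨s, hs, e, heX, hes⟩ := h
    symm
    refine Finset.prod_eq_zero hs ?_
    rw [neg_eq_zero]
    exact Finset.prod_eq_zero ((RelLoop.mem_support_perm s e).mpr hes) (by simp [eraseRows, heX])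

/-- For a fixed path, the loops avoiding it sum to the determinant with the rows of the path erased;
the sum over paths is then the expansion of the cofactor. -/
theorem loopSumFromTo_eq_adjugate (m ε δ : ℝ) (a f : TorusEdge T) :
    loopSumFromTo m ε δ a f =
      (1 - hopMatrix (ZMod (2 * T)) m ε δ).adjugate a f := by
  classical
  set w := hopMatrix (ZMod (2 * T)) m ε δ with hw
  have h0 := det_updateRow_single_eq_sum_paths w f _ ∅ a rfl (by simp) (by simp)
  rw [eraseRows_empty] at h0
  have h1 : loopSumFromTo m ε δ a f = ∑ p : TorusPath T with IsListFromTo ∅ a f p.1,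
      listWeight w p.1 * (1 - eraseRows w (∅ ∪ p.1.toFinset)).det := by
    rw [loopSumFromTo, Finset.sum_filter, Fintype.sum_prod_type, Finset.sum_filter]
    refine Finset.sum_congr rfl fun p _ => ?_
    rw [← sum_disjointLoops_avoiding_eq_det (r := Follows) w (hopMatrix_self m ε δ)
      (fun _ _ => hopMatrix_eq_zero m ε δ), Finset.empty_union, Finset.mul_sum, Finset.sum_filter]
    by_cases hp : IsListFromTo ∅ a f p.1
    · rw [if_pos hp]
      refine Finset.sum_congr rfl fun S _ => ?_
      have hiff : IsLoopConfigFromTo a f (p, S) ↔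
          (DisjointLoops (r := Follows) S ∧ ∀ s ∈ S, ∀ e ∈ p.1.toFinset, e ∉ s.1) := by
        constructor
        · rintro ⟨-, -, h3, h4⟩
          exact ⟨h3, fun s hs e he hes => h4 s hs e ⟨List.mem_toFinset.mp he, hes⟩⟩
        · rintro ⟨h3, h4⟩
          exact ⟨hp.1, hp.2.1, h3, fun s hs e he => h4 s hs e (List.mem_toFinset.mpr he.1) he.2⟩
      by_cases hS : IsLoopConfigFromTo a f (p, S)
      swap
      · rw [if_neg hS, if_neg fun h => hS (hiff.mpr h)]
      rw [if_pos hS, if_pos (hiff.mp hS), listWeight_hopMatrix_of_isChain m ε δ p.1 p.2.2,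
        pathArrow]
      exact congrArg _ (Finset.prod_congr rfl fun s _ => loopArrow_eq m ε δ s)
    · rw [if_neg hp]
      refine Finset.sum_eq_zero fun S _ => if_neg fun h => hp ⟨h.1, h.2.1, by simp⟩
  rw [h1, Matrix.adjugate_apply, h0]
  -- The cofactor expansion runs over all repetition-free lists; those that are not paths have
  -- weight zero.
  refine Finset.sum_of_injOn (fun p => ⟨p.1, p.2.1⟩) ?_ ?_ ?_ fun _ _ => rfl
  · intro p _ q _ h
    exact Subtype.ext (Subtype.mk.inj h)
  · intro p hp
    simpa using hp
  · rintro ⟨l, hl⟩ h hn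
    by_contra hne
    have hc := isChain_of_listWeight_hopMatrix_ne_zero m ε δ l (left_ne_zero_of_mul hne)
    exact hn ⟨⟨l, hl, hc⟩, by simpa using h, rfl⟩

/-- This is $\operatorname{adj}(1-w)(1-w)=\det(1-w)$ read along row $a$ and divided by the
determinant. -/
theorem finitePropagator_vecMul (m ε δ : ℝ) (a : TorusEdge T) (h : loopSum T m ε δ ≠ 0)
    (f : TorusEdge T) :
    finitePropagator m ε δ a f =
      ∑ e, finitePropagator m ε δ a e * hopMatrix (ZMod (2 * T)) m ε δ e f +
        (open Classical in if f = a then 1 else 0) := by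
  classical
  set w := hopMatrix (ZMod (2 * T)) m ε δ with hw
  have h1 := congrFun (congrFun (Matrix.adjugate_mul (1 - w)) a) f
  rw [Matrix.mul_apply, ← loopSum_eq_det] at h1
  simp only [Matrix.sub_apply, mul_sub, Finset.sum_sub_distrib, Matrix.smul_apply, smul_eq_mul,
    Matrix.one_apply, mul_ite, mul_one, mul_zero, Finset.sum_ite_eq', Finset.mem_univ,
    if_true] at h1
  have h2 : ∀ e, finitePropagator m ε δ a e = Matrix.adjugate (1 - w) a e / loopSum T m ε δ := by
    intro e
    rw [finitePropagator, loopSumFromTo_eq_adjugate]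
  simp only [h2]
  rw [div_eq_iff h, add_mul, Finset.sum_mul]
  have h3 : ∀ e, (1 - w).adjugate a e / loopSum T m ε δ * w e f * loopSum T m ε δ =
      (1 - w).adjugate a e * w e f := by
    intro e
    field_simp
  simp only [h3, eq_comm (a := f)]
  rw [ite_mul, one_mul, zero_mul, ← h1]
  ring

end TorusSums

/-! ### The energy estimate -/

theorem summable_energy_flux {Γ : Type*} [AddCommGroup Γ] {f : Γ → ℂ}
    (hf : Summable fun γ => ‖f γ‖ ^ 2) (τ : Γ) :
    Summable fun γ => (f (γ + τ) * (starRingEnd ℂ) (f γ)).im := by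
  have h1 : Summable fun γ => ‖f (γ + τ)‖ ^ 2 := 
    (Equiv.addRight τ).summable_iff (f := fun γ => ‖f γ‖ ^ 2) |>.mpr hf
  refine Summable.of_norm_bounded (h1.add hf) fun γ => ?_
  have h2 := Complex.abs_im_le_norm (f (γ + τ) * (starRingEnd ℂ) (f γ))
  rw [norm_mul, RCLike.norm_conj] at h2
  rw [Real.norm_eq_abs]
  nlinarith [sq_nonneg (‖f (γ + τ)‖ - ‖f γ‖), sq_nonneg (‖f (γ + τ)‖ + ‖f γ‖)]

/-- Multiply by $\bar f$ and take imaginary parts. The shifts by $\pm\tau$ and $\pm\xi$ become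
differences of fluxes $P(\gamma)-P(\gamma-\tau)$ with zero sum, while the term with $b$ gives
$-2b|f|^2$. It holds on any abelian group, hence on tori and on $\mathbb Z^2$ alike. -/
theorem sum_sq_le_of_scalar_equation {Γ : Type*} [AddCommGroup Γ] {f S : Γ → ℂ} {τ ξ : Γ}
    {κ b : ℝ} (hb : 0 < b) (hf : Summable fun γ => ‖f γ‖ ^ 2) (hS : Summable fun γ => ‖S γ‖ ^ 2)
    (h : ∀ γ, κ * (f (γ + τ) + f (γ - τ)) - f (γ + ξ) - f (γ - ξ) - 2 * Complex.I * b * f γ = S γ) :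
    4 * b ^ 2 * ∑' γ, ‖f γ‖ ^ 2 ≤ ∑' γ, ‖S γ‖ ^ 2 := by
  set P : Γ → Γ → ℝ := fun τ γ => (f (γ + τ) * (starRingEnd ℂ) (f γ)).im with hP
  have hPs : ∀ τ, Summable (P τ) := summable_energy_flux hf
  have hPs' : ∀ τ, Summable fun γ => P τ (γ - τ) := fun τ =>
    (Equiv.subRight τ).summable_iff (f := P τ) |>.mpr (hPs τ)
  have hPt : ∀ τ, ∑' γ, P τ (γ - τ) = ∑' γ, P τ γ := fun τ =>
    (Equiv.subRight τ).tsum_eq (P τ)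
  -- The product $|S||f|$ is absorbed by $4b|S||f|\le|S|^2+4b^2|f|^2$.
  have hpt : ∀ γ, 4 * b ^ 2 * ‖f γ‖ ^ 2 ≤ ‖S γ‖ ^ 2 +
      4 * b * (κ * (P τ γ - P τ (γ - τ)) - (P ξ γ - P ξ (γ - ξ))) := by
    intro γ
    have hid : (S γ * (starRingEnd ℂ) (f γ)).im =
        κ * (P τ γ - P τ (γ - τ)) - (P ξ γ - P ξ (γ - ξ)) - 2 * b * ‖f γ‖ ^ 2 := by
      rw [← h γ, hP, Complex.sq_norm, Complex.normSq_apply]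
      simp [Complex.mul_im, Complex.mul_re]
      ring
    have h2 := Complex.abs_im_le_norm (S γ * (starRingEnd ℂ) (f γ))
    rw [norm_mul, RCLike.norm_conj, hid] at h2
    have h3 := (abs_le.mp h2).1
    nlinarith [sq_nonneg (‖S γ‖ - 2 * b * ‖f γ‖)]
  have hs1 : Summable fun γ => κ * (P τ γ - P τ (γ - τ)) - (P ξ γ - P ξ (γ - ξ)) :=
    (((hPs τ).sub (hPs' τ)).mul_left κ).sub ((hPs ξ).sub (hPs' ξ))
  have hz : ∑' γ, (κ * (P τ γ - P τ (γ - τ)) - (P ξ γ - P ξ (γ - ξ))) = 0 := by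
    rw [(((hPs τ).sub (hPs' τ)).mul_left κ).tsum_sub ((hPs ξ).sub (hPs' ξ)), tsum_mul_left,
      (hPs τ).tsum_sub (hPs' τ), (hPs ξ).tsum_sub (hPs' ξ), hPt, hPt]
    ring
  have h4 := (hf.mul_left (4 * b ^ 2)).tsum_le_tsum hpt (hS.add (hs1.mul_left (4 * b)))
  rwa [tsum_mul_left, hS.tsum_add (hs1.mul_left _), tsum_mul_left, hz, mul_zero, add_zero] at h4

/-! ### The two-component evolution on even points -/

/-- The evolution of a pair of functions by two steps of the lattice, with a source `s` for
the second function. The sign `y` distinguishes incoming and outgoing edges. -/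
structure IsEvolution {R : Type} [CommRing R] (κ μ δ : ℝ) (y : R) (s u v : R × R → ℂ) : Prop where
  fst : ∀ n j, κ * u (n, j + 1) = u (n + 1, j) + Complex.I * μ * δ * u (n, j) -
    Complex.I * μ * v (n, j) - δ * v (n - y, j)
  snd : ∀ n j, κ * v (n, j + 1) = v (n - 1, j) + Complex.I * μ * δ * v (n, j) -
    Complex.I * μ * u (n, j) - δ * u (n + y, j) + κ * s (n, j + 1)

namespace IsEvolution

variable {R : Type} [CommRing R] {κ μ δ : ℝ} {y : R} {s u v : R × R → ℂ}

/-- Cayley–Hamilton for the symbol of the evolution: its trace is $2\cos p+2i\mu\delta$ and its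
determinant is $\kappa^2$, for either sign of $y$. The proof eliminates `v` by combining the
equations at times $j$ and $j-1$. -/
theorem scalar_fst (h : IsEvolution κ μ δ y s u v) (hκ : κ ^ 2 = (1 + μ ^ 2) * (1 - δ ^ 2))
    (hκ0 : κ ≠ 0) (hy : y = 1 ∨ y = -1) (n j : R) :
    κ * (u (n, j + 1) + u (n, j - 1)) - u (n + 1, j) - u (n - 1, j) -
      2 * Complex.I * (μ * δ : ℝ) * u (n, j) =
      -Complex.I * μ * s (n, j) - δ * s (n - y, j) := by
  have h1 := h.fst n j
  have h2 := h.fst (n - 1) (j - 1)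
  have h3 := h.fst n (j - 1)
  have h4 := h.snd n (j - 1)
  have h5 := h.snd (n - y) (j - 1)
  have hκ' : (κ : ℂ) ^ 2 = (1 + (μ : ℂ) ^ 2) * (1 - (δ : ℂ) ^ 2) := by exact_mod_cast hκ
  have hκ0' : (κ : ℂ) ≠ 0 := by exact_mod_cast hκ0
  rw [sub_add_cancel] at h2 h3 h4 h5
  push_cast
  refine mul_left_cancel₀ hκ0' ?_
  rcases hy with rfl | rfl
  · simp only [sub_add_cancel] at h2 h5
    linear_combination (κ : ℂ) * h1 - h2 - Complex.I * μ * δ * h3 - Complex.I * μ * h4 - δ * h5 +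
      u (n, j - 1) * hκ' + u (n, j - 1) * (μ ^ 2 - δ ^ 2 * μ ^ 2) * Complex.I_sq
  · simp only [sub_add_cancel, sub_neg_eq_add, add_sub_cancel_right, ← sub_eq_add_neg]
      at h1 h2 h3 h4 h5 ⊢
    linear_combination (κ : ℂ) * h1 - h2 - Complex.I * μ * δ * h3 - Complex.I * μ * h4 - δ * h5 +
      u (n, j - 1) * hκ' + u (n, j - 1) * (μ ^ 2 - δ ^ 2 * μ ^ 2) * Complex.I_sq

theorem scalar_snd (h : IsEvolution κ μ δ y s u v) (hκ : κ ^ 2 = (1 + μ ^ 2) * (1 - δ ^ 2))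
    (hκ0 : κ ≠ 0) (hy : y = 1 ∨ y = -1) (n j : R) :
    κ * (v (n, j + 1) + v (n, j - 1)) - v (n + 1, j) - v (n - 1, j) -
      2 * Complex.I * (μ * δ : ℝ) * v (n, j) =
      κ * s (n, j + 1) - s (n + 1, j) - Complex.I * μ * δ * s (n, j) := by
  have h1 := h.snd n j
  have h2 := h.snd (n + 1) (j - 1)
  have h3 := h.snd n (j - 1)
  have h4 := h.fst n (j - 1)
  have h5 := h.fst (n + y) (j - 1)
  have hκ' : (κ : ℂ) ^ 2 = (1 + (μ : ℂ) ^ 2) * (1 - (δ : ℂ) ^ 2) := by exact_mod_cast hκ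
  have hκ0' : (κ : ℂ) ≠ 0 := by exact_mod_cast hκ0
  rw [sub_add_cancel] at h2 h3 h4 h5
  push_cast
  refine mul_left_cancel₀ hκ0' ?_
  rcases hy with rfl | rfl
  · simp only [add_sub_cancel_right] at h2 h5
    linear_combination (κ : ℂ) * h1 - h2 - Complex.I * μ * δ * h3 - Complex.I * μ * h4 - δ * h5 +
      v (n, j - 1) * hκ' + v (n, j - 1) * (μ ^ 2 - δ ^ 2 * μ ^ 2) * Complex.I_sq
  · simp only [sub_neg_eq_add, ← sub_eq_add_neg, add_sub_cancel_right, sub_add_cancel]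
      at h1 h2 h3 h4 h5 ⊢
    linear_combination (κ : ℂ) * h1 - h2 - Complex.I * μ * δ * h3 - Complex.I * μ * h4 - δ * h5 +
      v (n, j - 1) * hκ' + v (n, j - 1) * (μ ^ 2 - δ ^ 2 * μ ^ 2) * Complex.I_sq

theorem sub {u' v' : R × R → ℂ} (h : IsEvolution κ μ δ y s u v)
    (h' : IsEvolution κ μ δ y s u' v') : IsEvolution κ μ δ y 0 (u - u') (v - v') where
  fst n j := by
    have h1 := h.fst n j
    have h2 := h'.fst n j
    simp only [Pi.sub_apply]
    linear_combination h1 - h2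
  snd n j := by
    have h1 := h.snd n j
    have h2 := h'.snd n j
    simp only [Pi.sub_apply, Pi.zero_apply]
    linear_combination h1 - h2

theorem tsum_fst_le (h : IsEvolution κ μ δ y s u v) (hκ : κ ^ 2 = (1 + μ ^ 2) * (1 - δ ^ 2))
    (hκ0 : κ ≠ 0) (hy : y = 1 ∨ y = -1) (hμδ : 0 < μ * δ)
    (hu : Summable fun γ => ‖u γ‖ ^ 2) (hs : Summable fun γ => ‖s γ‖ ^ 2) :
    4 * (μ * δ) ^ 2 * ∑' γ, ‖u γ‖ ^ 2 ≤ 2 * (μ ^ 2 + δ ^ 2) * ∑' γ, ‖s γ‖ ^ 2 := by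
  have hs' : Summable fun γ : R × R => ‖s (γ - (y, 0))‖ ^ 2 :=
    (Equiv.subRight (y, (0 : R))).summable_iff (f := fun γ => ‖s γ‖ ^ 2) |>.mpr hs
  have hst : ∑' γ : R × R, ‖s (γ - (y, 0))‖ ^ 2 = ∑' γ, ‖s γ‖ ^ 2 :=
    (Equiv.subRight (y, (0 : R))).tsum_eq (fun γ => ‖s γ‖ ^ 2)
  have hb : ∀ γ : R × R, ‖-Complex.I * μ * s γ - δ * s (γ - (y, 0))‖ ^ 2 ≤
      2 * μ ^ 2 * ‖s γ‖ ^ 2 + 2 * δ ^ 2 * ‖s (γ - (y, 0))‖ ^ 2 := by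
    intro γ
    have h1 := norm_sub_le (-Complex.I * μ * s γ) (δ * s (γ - (y, 0)))
    simp only [norm_mul, norm_neg, Complex.norm_I, one_mul, Complex.norm_real,
      Real.norm_eq_abs] at h1
    have h2 := pow_le_pow_left₀ (norm_nonneg _) h1 2
    refine h2.trans ?_
    nlinarith [sq_nonneg (|μ| * ‖s γ‖ - |δ| * ‖s (γ - (y, 0))‖), sq_abs μ, sq_abs δ]
  have hr := (hs.mul_left (2 * μ ^ 2)).add (hs'.mul_left (2 * δ ^ 2))
  have hS := Summable.of_nonneg_of_le (fun _ => sq_nonneg _) hb hr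
  have h1 := sum_sq_le_of_scalar_equation (τ := ((0 : R), (1 : R))) (ξ := ((1 : R), (0 : R)))
    (κ := κ) hμδ hu hS fun ⟨n, j⟩ => by
      have := h.scalar_fst hκ hκ0 hy n j
      simpa using this
  refine h1.trans ((hS.tsum_le_tsum hb hr).trans_eq ?_)
  rw [(hs.mul_left _).tsum_add (hs'.mul_left _), tsum_mul_left, tsum_mul_left, hst]
  ring

theorem tsum_snd_le (h : IsEvolution κ μ δ y s u v) (hκ : κ ^ 2 = (1 + μ ^ 2) * (1 - δ ^ 2))
    (hκ0 : κ ≠ 0) (hy : y = 1 ∨ y = -1) (hμδ : 0 < μ * δ)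
    (hv : Summable fun γ => ‖v γ‖ ^ 2) (hs : Summable fun γ => ‖s γ‖ ^ 2) :
    4 * (μ * δ) ^ 2 * ∑' γ, ‖v γ‖ ^ 2 ≤
      3 * (κ ^ 2 + 1 + (μ * δ) ^ 2) * ∑' γ, ‖s γ‖ ^ 2 := by
  have hs' : ∀ a : R × R, Summable fun γ : R × R => ‖s (γ + a)‖ ^ 2 := fun a =>
    (Equiv.addRight a).summable_iff (f := fun γ => ‖s γ‖ ^ 2) |>.mpr hs
  have hst : ∀ a : R × R, ∑' γ : R × R, ‖s (γ + a)‖ ^ 2 = ∑' γ, ‖s γ‖ ^ 2 := fun a =>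
    (Equiv.addRight a).tsum_eq (fun γ => ‖s γ‖ ^ 2)
  have hb : ∀ γ : R × R,
      ‖κ * s (γ + (0, 1)) - s (γ + (1, 0)) - Complex.I * μ * δ * s γ‖ ^ 2 ≤
      3 * κ ^ 2 * ‖s (γ + (0, 1))‖ ^ 2 + 3 * ‖s (γ + (1, 0))‖ ^ 2 +
        3 * (μ * δ) ^ 2 * ‖s γ‖ ^ 2 := by
    intro γ
    have h1 := (norm_sub_le (κ * s (γ + (0, 1)) - s (γ + (1, 0)))
      (Complex.I * μ * δ * s γ)).trans (add_le_add_left (norm_sub_le _ _) _)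
    simp only [norm_mul, Complex.norm_I, one_mul, Complex.norm_real, Real.norm_eq_abs] at h1
    rw [← abs_mul] at h1
    have h2 := pow_le_pow_left₀ (norm_nonneg _) h1 2
    refine h2.trans ?_
    nlinarith [sq_nonneg (|κ| * ‖s (γ + (0, 1))‖ - ‖s (γ + (1, 0))‖),
      sq_nonneg (|κ| * ‖s (γ + (0, 1))‖ - |μ * δ| * ‖s γ‖),
      sq_nonneg (‖s (γ + (1, 0))‖ - |μ * δ| * ‖s γ‖), sq_abs κ, sq_abs (μ * δ)]
  have hr := (((hs' (0, 1)).mul_left (3 * κ ^ 2)).add ((hs' (1, 0)).mul_left 3)).add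
    (hs.mul_left (3 * (μ * δ) ^ 2))
  have hS := Summable.of_nonneg_of_le (fun _ => sq_nonneg _) hb hr
  have h1 := sum_sq_le_of_scalar_equation (τ := ((0 : R), (1 : R))) (ξ := ((1 : R), (0 : R)))
    (κ := κ) hμδ hv hS fun ⟨n, j⟩ => by
      have := h.scalar_snd hκ hκ0 hy n j
      simpa using this
  refine h1.trans ((hS.tsum_le_tsum hb hr).trans_eq ?_)
  rw [(((hs' (0, 1)).mul_left _).add ((hs' (1, 0)).mul_left _)).tsum_add (hs.mul_left _),
    ((hs' (0, 1)).mul_left _).tsum_add ((hs' (1, 0)).mul_left _), tsum_mul_left, tsum_mul_left,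
    tsum_mul_left, hst, hst]
  ring

theorem eq_zero_of_tsum_le {Γ : Type*} {f : Γ → ℂ} (hf : Summable fun γ => ‖f γ‖ ^ 2) {c : ℝ}
    (hc : 0 < c) (h : c * ∑' γ, ‖f γ‖ ^ 2 ≤ 0) : f = 0 := by
  have h1 : ∑' γ, ‖f γ‖ ^ 2 = 0 :=
    le_antisymm (nonpos_of_mul_nonpos_right h hc) (tsum_nonneg fun _ => sq_nonneg _)
  have h2 := (hasSum_zero_iff_of_nonneg fun γ => sq_nonneg ‖f γ‖).mp (h1 ▸ hf.hasSum)
  funext γ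
  simpa using congrFun h2 γ

theorem eq_zero (h : IsEvolution κ μ δ y 0 u v) (hκ : κ ^ 2 = (1 + μ ^ 2) * (1 - δ ^ 2))
    (hκ0 : κ ≠ 0) (hy : y = 1 ∨ y = -1) (hμδ : 0 < μ * δ)
    (hu : Summable fun γ => ‖u γ‖ ^ 2) (hv : Summable fun γ => ‖v γ‖ ^ 2) : u = 0 ∧ v = 0 := by
  have hs : Summable fun γ : R × R => ‖(0 : R × R → ℂ) γ‖ ^ 2 := by simp
  have h1 := h.tsum_fst_le hκ hκ0 hy hμδ hu hs
  have h2 := h.tsum_snd_le hκ hκ0 hy hμδ hv hs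
  simp only [Pi.zero_apply, norm_zero, ne_eq, OfNat.ofNat_ne_zero, not_false_eq_true, zero_pow,
    tsum_zero, mul_zero] at h1 h2
  exact ⟨eq_zero_of_tsum_le hu (by positivity) h1, eq_zero_of_tsum_le hv (by positivity) h2⟩

theorem summable_sub {Γ : Type*} {f g : Γ → ℂ} (hf : Summable fun γ => ‖f γ‖ ^ 2)
    (hg : Summable fun γ => ‖g γ‖ ^ 2) : Summable fun γ => ‖(f - g) γ‖ ^ 2 := by
  refine Summable.of_nonneg_of_le (fun _ => sq_nonneg _) (fun γ => ?_)
    ((hf.mul_left 2).add (hg.mul_left 2))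
  have h1 := pow_le_pow_left₀ (norm_nonneg _) (norm_sub_le (f γ) (g γ)) 2
  rw [Pi.sub_apply]
  nlinarith [sq_nonneg (‖f γ‖ - ‖g γ‖)]

theorem unique {u' v' : R × R → ℂ} (h : IsEvolution κ μ δ y s u v)
    (h' : IsEvolution κ μ δ y s u' v') (hκ : κ ^ 2 = (1 + μ ^ 2) * (1 - δ ^ 2))
    (hκ0 : κ ≠ 0) (hy : y = 1 ∨ y = -1) (hμδ : 0 < μ * δ)
    (hu : Summable fun γ => ‖u γ‖ ^ 2) (hv : Summable fun γ => ‖v γ‖ ^ 2)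
    (hu' : Summable fun γ => ‖u' γ‖ ^ 2) (hv' : Summable fun γ => ‖v' γ‖ ^ 2) :
    u = u' ∧ v = v' := by
  have h1 := (h.sub h').eq_zero hκ hκ0 hy hμδ (summable_sub hu hu') (summable_sub hv hv')
  exact ⟨sub_eq_zero.mp h1.1, sub_eq_zero.mp h1.2⟩

/-- A scalar Green function gives a solution of the two-component system. -/
theorem of_scalar {φ s : R × R → ℂ} (c : ℂ) (hκ : κ ^ 2 = (1 + μ ^ 2) * (1 - δ ^ 2))
    (hκ0 : κ ≠ 0) (hy : y = 1 ∨ y = -1)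
    (h : ∀ n j, κ * (φ (n, j + 1) + φ (n, j - 1)) - φ (n + 1, j) - φ (n - 1, j) -
      2 * Complex.I * μ * δ * φ (n, j) = κ * s (n, j)) :
    IsEvolution κ μ δ y (fun γ => c * s γ)
      (fun γ => c * (-Complex.I * μ * φ γ - δ * φ (γ.1 - y, γ.2)) / κ)
      (fun γ => c * (φ (γ.1, γ.2 + 1) - (φ (γ.1 + 1, γ.2) + Complex.I * μ * δ * φ γ) / κ)) := by
  have hκ' : (κ : ℂ) ^ 2 = (1 + (μ : ℂ) ^ 2) * (1 - (δ : ℂ) ^ 2) := by exact_mod_cast hκ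
  have hκ0' : (κ : ℂ) ≠ 0 := by exact_mod_cast hκ0
  refine ⟨fun n j => ?_, fun n j => ?_⟩
  · field_simp
    rcases hy with rfl | rfl
    · simp only [sub_add_cancel]
      ring_nf
    · simp only [sub_neg_eq_add]
      ring_nf
  · have h1 := h n (j + 1)
    rw [add_sub_cancel_right] at h1
    field_simp
    rcases hy with rfl | rfl
    · simp only [sub_add_cancel, add_sub_cancel_right]
      linear_combination (c * κ) * h1 - c * φ (n, j) * hκ' +
        c * φ (n, j) * (δ ^ 2 * μ ^ 2 - μ ^ 2) * Complex.I_sq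
    · simp only [sub_neg_eq_add, ← sub_eq_add_neg, sub_add_cancel]
      linear_combination (c * κ) * h1 - c * φ (n, j) * hκ' +
        c * φ (n, j) * (δ ^ 2 * μ ^ 2 - μ ^ 2) * Complex.I_sq

end IsEvolution

/-! ### Even and odd points -/

/-- A ring with exactly two classes of elements modulo two. -/
structure HasParity (R : Type) [CommRing R] : Prop where
  not_even_one : ¬ Even (1 : R)
  even_or_even_add_one : ∀ a : R, Even a ∨ Even (a + 1)

theorem hasParity_int : HasParity ℤ where
  not_even_one := by decide
  even_or_even_add_one a := by
    rcases Int.even_or_odd a with h | h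
    · exact Or.inl h
    · exact Or.inr h.add_one

theorem hasParity_zmod (T : ℕ) [NeZero T] : HasParity (ZMod (2 * T)) where
  not_even_one := by
    rintro ⟨r, hr⟩
    -- If $1=2r$, then $T=2Tr=0$ modulo $2T$, which is impossible.
    have h1 : ((T : ℕ) : ZMod (2 * T)) = 0 := by
      have h2 : (T : ZMod (2 * T)) * 1 = T * (r + r) := by rw [← hr]
      have h3 : ((2 * T : ℕ) : ZMod (2 * T)) = 0 := ZMod.natCast_self _
      push_cast at h3
      rw [mul_one] at h2
      rw [h2]
      linear_combination r * h3
    rw [ZMod.natCast_eq_zero_iff] at h1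
    have h2 := Nat.le_of_dvd (Nat.pos_of_ne_zero (NeZero.ne T)) h1
    have := NeZero.ne T
    omega
  even_or_even_add_one a := by
    obtain ⟨k, rfl⟩ := ZMod.intCast_surjective a
    rcases Int.even_or_odd k with h | h
    · exact Or.inl (h.map (Int.castRingHom (ZMod (2 * T))))
    · right
      have := h.add_one.map (Int.castRingHom (ZMod (2 * T)))
      simpa using this

section Points

variable {R : Type} [CommRing R]

theorem Dir.sum_eq {M : Type*} [AddCommMonoid M] (f : Dir → M) :
    ∑ d, f d = f .left + f .right := by
  change ∑ d ∈ {Dir.left, Dir.right}, f d = _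
  rw [Finset.sum_pair (by decide)]

theorem Site.next_prev (d : Dir) (p : Site R) : (p.prev d).next d = p := by
  cases d <;> ext <;> simp [Site.next, Site.prev]

theorem Site.prev_next (d : Dir) (p : Site R) : (p.next d).prev d = p := by
  cases d <;> ext <;> simp [Site.next, Site.prev]

/-- The even point with given coordinates. -/
def evenPoint (γ : R × R) : Site R := ⟨(2 * γ.1, 2 * γ.2), ⟨γ.1 + γ.2, by ring⟩⟩

theorem evenSite_eq_evenPoint (n j : ℤ) : evenSite R n j = evenPoint ((n : R), (j : R)) := rfl

theorem isEven_evenPoint (γ : R × R) : (evenPoint γ).IsEven := even_two_mul _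

theorem Site.IsEven.exists_eq {p : Site R} (h : p.IsEven) : ∃ γ, p = evenPoint γ := by
  obtain ⟨⟨x, t⟩, hp⟩ := p
  obtain ⟨n, hn⟩ := h
  obtain ⟨k, hk⟩ := hp
  simp only at hn hk
  refine ⟨(n, k - n), Subtype.ext (Prod.ext ?_ ?_)⟩
  · simp only [evenPoint]
    rw [hn]; ring
  · simp only [evenPoint]
    linear_combination hk - hn

theorem HasParity.not_isEven_prev (hR : HasParity R) {p : Site R} (hp : p.IsEven) (d : Dir) :
    ¬ (p.prev d).IsEven := by
  intro h
  have h1 : Even p.1.1 := hp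
  refine hR.not_even_one ?_
  cases d
  · have h2 : Even (p.1.1 + 1) := h
    simpa using h2.sub h1
  · have h2 : Even (p.1.1 - 1) := h
    simpa using h1.sub h2

theorem HasParity.isEven_prev (hR : HasParity R) {p : Site R} (hp : ¬ p.IsEven) (d : Dir) :
    (p.prev d).IsEven := by
  have h1 : Even (p.1.1 + 1) := (hR.even_or_even_add_one p.1.1).resolve_left hp
  cases d
  · exact h1
  · have : Even (p.1.1 + 1 - (1 + 1)) := h1.sub ⟨1, rfl⟩
    have h2 : p.1.1 + 1 - (1 + 1) = p.1.1 - 1 := by ring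
    rw [h2] at this
    exact this

theorem evenPoint_prev_left_prev_left (n j : R) :
    ((evenPoint (n, j + 1)).prev .left).prev .left = evenPoint (n + 1, j) := by
  ext <;> simp [Site.prev, evenPoint] <;> ring_nf

theorem evenPoint_prev_left_prev_right (n j : R) :
    ((evenPoint (n, j + 1)).prev .left).prev .right = evenPoint (n, j) := by
  ext <;> simp [Site.prev, evenPoint]; ring

theorem evenPoint_prev_right_prev_left (n j : R) :
    ((evenPoint (n, j + 1)).prev .right).prev .left = evenPoint (n, j) := by
  ext <;> simp [Site.prev, evenPoint]; ring

theorem evenPoint_prev_right_prev_right (n j : R) :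
    ((evenPoint (n, j + 1)).prev .right).prev .right = evenPoint (n - 1, j) := by
  ext <;> simp [Site.prev, evenPoint] <;> ring_nf

/-! ### The equation for functions of edges -/

/-- The lattice equation for functions of edges, with a source. -/
def EdgeEquation (m ε δ : ℝ) (g src : Edge R → ℂ) : Prop :=
  ∀ (p : Site R) (d : Dir), g (p, d) =
    ∑ d', g (p.prev d', d') * stepWeight m ε δ ((p.prev d', d'), (p, d)) + src (p, d)

variable {m ε δ : ℝ} {g src : Edge R → ℂ}

theorem stepWeight_prev_even {p : Site R} (hp : p.IsEven) (d d' : Dir) :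
    stepWeight m ε δ ((p.prev d', d'), (p, d)) =
      (if d' = d then 1 else -(δ : ℂ)) / (√(1 - δ ^ 2) : ℝ) := by
  have ht : (Edge.target (p.prev d', d')).IsEven := by
    rwa [show Edge.target (p.prev d', d') = p from Site.next_prev d' p]
  by_cases h : d' = d
  · subst h
    simp [stepWeight, ht]
  · simp [stepWeight, ht, h]

theorem stepWeight_prev_odd {p : Site R} (hp : ¬ p.IsEven) (d d' : Dir) :
    stepWeight m ε δ ((p.prev d', d'), (p, d)) =
      (if d' = d then 1 else -Complex.I * m * ε) / (√(1 + m ^ 2 * ε ^ 2) : ℝ) := by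
  have ht : ¬ (Edge.target (p.prev d', d')).IsEven := by
    rwa [show Edge.target (p.prev d', d') = p from Site.next_prev d' p]
  by_cases h : d' = d
  · subst h
    simp [stepWeight, ht]
  · simp [stepWeight, ht, h]

/-- The normalization of two consecutive steps. -/
noncomputable def stepNorm (m ε δ : ℝ) : ℝ := √(1 + m ^ 2 * ε ^ 2) * √(1 - δ ^ 2)

theorem sqrt_odd_pos (m ε : ℝ) : 0 < √(1 + m ^ 2 * ε ^ 2) := Real.sqrt_pos.mpr (by positivity)

theorem sqrt_even_pos (h0 : 0 < δ) (h1 : δ < 1) : 0 < √(1 - δ ^ 2) :=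
  Real.sqrt_pos.mpr (by nlinarith)

theorem stepNorm_pos (h0 : 0 < δ) (h1 : δ < 1) : 0 < stepNorm m ε δ :=
  mul_pos (sqrt_odd_pos m ε) (sqrt_even_pos h0 h1)

theorem stepNorm_sq (h0 : 0 < δ) (h1 : δ < 1) :
    stepNorm m ε δ ^ 2 = (1 + (m * ε) ^ 2) * (1 - δ ^ 2) := by
  rw [stepNorm, mul_pow, Real.sq_sqrt (by positivity), Real.sq_sqrt (by nlinarith)]
  ring

/-- Two consecutive steps, through odd points, lead from even points to even points; hence the
normalization is the product of the two square roots. -/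
theorem EdgeEquation.isEvolution (hR : HasParity R) (h0 : 0 < δ) (h1 : δ < 1)
    (h : EdgeEquation m ε δ g src)
    (hsrc : ∀ p d, (¬ p.IsEven ∨ d = .left) → src (p, d) = 0) :
    IsEvolution (stepNorm m ε δ) (m * ε) δ (1 : R) (fun γ => src (evenPoint γ, .right))
      (fun γ => g (evenPoint γ, .left)) (fun γ => g (evenPoint γ, .right)) := by
  have hr : ((√(1 - δ ^ 2) : ℝ) : ℂ) ≠ 0 := by exact_mod_cast (sqrt_even_pos h0 h1).ne'
  have hs : ((√(1 + m ^ 2 * ε ^ 2) : ℝ) : ℂ) ≠ 0 := by exact_mod_cast (sqrt_odd_pos m ε).ne'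
  have hodd : ∀ (p : Site R) (d d' : Dir), p.IsEven →
      (√(1 + m ^ 2 * ε ^ 2) : ℝ) * g (p.prev d', d) =
      ∑ e, g ((p.prev d').prev e, e) * (if e = d then 1 else -Complex.I * m * ε) := by
    intro p d d' hp
    have hnp := hR.not_isEven_prev hp d'
    rw [h, hsrc _ _ (Or.inl hnp), Dir.sum_eq, Dir.sum_eq, stepWeight_prev_odd hnp,
      stepWeight_prev_odd hnp]
    field_simp
    ring
  have heven : ∀ (p : Site R) (d : Dir), p.IsEven → (√(1 - δ ^ 2) : ℝ) * g (p, d) =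
      ∑ e, g (p.prev e, e) * (if e = d then 1 else -(δ : ℂ)) + (√(1 - δ ^ 2) : ℝ) * src (p, d) := by
    intro p d hp
    rw [h, Dir.sum_eq, Dir.sum_eq, stepWeight_prev_even hp, stepWeight_prev_even hp]
    field_simp
  refine ⟨fun n j => ?_, fun n j => ?_⟩
  · have he := isEven_evenPoint (n, j + 1)
    have h2 := heven _ .left he
    have h3 := hodd _ .left .left he
    have h4 := hodd _ .right .right he
    rw [hsrc _ _ (Or.inr rfl)] at h2
    simp only [Dir.sum_eq, evenPoint_prev_left_prev_left, evenPoint_prev_left_prev_right,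
      evenPoint_prev_right_prev_left, evenPoint_prev_right_prev_right, reduceCtorEq, if_true,
      if_false] at h2 h3 h4
    rw [stepNorm]
    push_cast
    linear_combination (√(1 + m ^ 2 * ε ^ 2) : ℝ) * h2 + h3 - δ * h4
  · have he := isEven_evenPoint (n, j + 1)
    have h2 := heven _ .right he
    have h3 := hodd _ .left .left he
    have h4 := hodd _ .right .right he
    simp only [Dir.sum_eq, evenPoint_prev_left_prev_left, evenPoint_prev_left_prev_right,
      evenPoint_prev_right_prev_left, evenPoint_prev_right_prev_right, reduceCtorEq, if_true,
      if_false] at h2 h3 h4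
    rw [stepNorm]
    push_cast
    linear_combination (√(1 + m ^ 2 * ε ^ 2) : ℝ) * h2 - δ * h3 + h4

end Points

/-! ### The torus -/

section Torus

variable {T : ℕ} [NeZero T] {m ε δ : ℝ}

theorem sum_mul_hopMatrix (g : TorusEdge T → ℂ) (p : Site (ZMod (2 * T))) (d : Dir) :
    ∑ e, g e * hopMatrix (ZMod (2 * T)) m ε δ e (p, d) =
      ∑ d', g (p.prev d', d') * stepWeight m ε δ ((p.prev d', d'), (p, d)) := by
  symm
  refine Finset.sum_of_injOn (fun d' => (p.prev d', d')) ?_ (fun _ _ => by simp) ?_ ?_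
  · intro d1 _ d2 _ h
    exact congrArg Prod.snd h
  · rintro ⟨q, d'⟩ _ hn
    rw [hopMatrix_eq_zero, mul_zero]
    intro hf
    refine hn ⟨d', by simp, ?_⟩
    have hf' : q.next d' = p := hf
    simp only [← hf', Site.prev_next]
  · intro d' _
    rw [hopMatrix_eq]
    exact Site.next_prev d' p

/-- The energy estimate without a source kills the values at even points, and these determine the
values at odd points. -/
theorem edgeEquation_eq_zero (hμ : 0 < m * ε) (h0 : 0 < δ) (h1 : δ < 1) {g : TorusEdge T → ℂ}
    (h : EdgeEquation m ε δ g 0) : g = 0 := by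
  have hR := hasParity_zmod T
  have hev := h.isEvolution hR h0 h1 (fun _ _ _ => rfl)
  have hz := IsEvolution.eq_zero (hev : IsEvolution _ _ _ _ 0 _ _) (stepNorm_sq h0 h1)
    (stepNorm_pos h0 h1).ne' (Or.inl rfl) (mul_pos hμ h0) (hasSum_fintype _).summable
    (hasSum_fintype _).summable
  have heven : ∀ p d, p.IsEven → g (p, d) = 0 := by
    intro p d hp
    obtain ⟨γ, rfl⟩ := hp.exists_eq
    cases d
    · exact congrFun hz.1 γ
    · exact congrFun hz.2 γ
  funext ⟨p, d⟩
  by_cases hp : p.IsEven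
  · exact heven p d hp
  · rw [h p d, Dir.sum_eq, heven _ _ (hR.isEven_prev hp _), heven _ _ (hR.isEven_prev hp _)]
    simp

/-- A vector in the left kernel of $1-w$ solves the edge equation without a source. -/
theorem loopSum_ne_zero (hμ : 0 < m * ε) (h0 : 0 < δ) (h1 : δ < 1) : loopSum T m ε δ ≠ 0 := by
  classical
  rw [loopSum_eq_det]
  intro hdet
  obtain ⟨v, hv0, hv⟩ := Matrix.exists_vecMul_eq_zero_iff.mpr hdet
  refine hv0 (edgeEquation_eq_zero hμ h0 h1 fun p d => ?_)
  rw [Matrix.vecMul_sub, Matrix.vecMul_one, sub_eq_zero] at hv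
  have h2 := congrFun hv (p, d)
  rw [Pi.zero_apply, add_zero, ← sum_mul_hopMatrix]
  exact h2

open Classical in
theorem edgeEquation_finitePropagator (hμ : 0 < m * ε) (h0 : 0 < δ) (h1 : δ < 1)
    (a : TorusEdge T) :
    EdgeEquation m ε δ (finitePropagator m ε δ a) (fun e => if e = a then 1 else 0) := by
  intro p d
  rw [← sum_mul_hopMatrix]
  exact finitePropagator_vecMul m ε δ a (loopSum_ne_zero hμ h0 h1) (p, d)

end Torus

/-! ### The limit of large tori -/

theorem IsEvolution.comp {R S : Type} [CommRing R] [CommRing S] (φ : S →+* R) {κ μ δ : ℝ} {y : S}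
    {s u v : R × R → ℂ} (h : IsEvolution κ μ δ (φ y) s u v) :
    IsEvolution κ μ δ y (s ∘ Prod.map φ φ) (u ∘ Prod.map φ φ) (v ∘ Prod.map φ φ) where
  fst n j := by simpa using h.fst (φ n) (φ j)
  snd n j := by simpa using h.snd (φ n) (φ j)

theorem eventually_intCast_ne_zero {a : ℤ} (ha : a ≠ 0) :
    ∀ᶠ T : ℕ+ in atTop, (a : ZMod (2 * (T : ℕ))) ≠ 0 := by
  have hpos : 0 < a.natAbs := Int.natAbs_pos.mpr ha
  filter_upwards [eventually_ge_atTop (⟨a.natAbs, hpos⟩ : ℕ+)] with T hT h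
  rw [ZMod.intCast_zmod_eq_zero_iff_dvd] at h
  have h1 := Int.natAbs_dvd_natAbs.mpr h
  have h2 := Nat.le_of_dvd hpos h1
  have h3 : a.natAbs ≤ (T : ℕ) := hT
  simp only [Int.natAbs_natCast] at h2
  have := T.pos
  omega

/-- A finite piece of the plane embeds in all large tori, so bounds on the torus pass to finite sums
over $\mathbb Z^2$. -/
theorem eventually_intCast_injOn (F : Finset (ℤ × ℤ)) :
    ∀ᶠ T : ℕ+ in atTop, Set.InjOn
      (Prod.map (Int.castRingHom (ZMod (2 * (T : ℕ))))
        (Int.castRingHom (ZMod (2 * (T : ℕ))))) F := by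
  have h : ∀ p ∈ F, ∀ q ∈ F, ∀ᶠ T : ℕ+ in atTop,
      Prod.map (Int.castRingHom (ZMod (2 * (T : ℕ)))) (Int.castRingHom (ZMod (2 * (T : ℕ)))) p =
      Prod.map (Int.castRingHom (ZMod (2 * (T : ℕ)))) (Int.castRingHom (ZMod (2 * (T : ℕ)))) q →
      p = q := by
    intro p _ q _
    by_cases hpq : p = q
    · exact Eventually.of_forall fun _ _ => hpq
    · have hor : p.1 - q.1 ≠ 0 ∨ p.2 - q.2 ≠ 0 := by
        by_contra hc
        push Not at hc
        exact hpq (Prod.ext (sub_eq_zero.mp hc.1) (sub_eq_zero.mp hc.2))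
      rcases hor with hne | hne
      · filter_upwards [eventually_intCast_ne_zero hne] with T hT he
        refine absurd ?_ hT
        have := congrArg Prod.fst he
        simpa [sub_eq_zero] using this
      · filter_upwards [eventually_intCast_ne_zero hne] with T hT he
        refine absurd ?_ hT
        have := congrArg Prod.snd he
        simpa [sub_eq_zero] using this
  have h2 := (F.eventually_all).mpr fun p hp => (F.eventually_all).mpr (h p hp)
  filter_upwards [h2] with T hT p hp q hq he
  exact hT p hp q hq he

open Classical in
/-- The unit source at the origin. -/
noncomputable def unitSource (R : Type) [CommRing R] (γ : R × R) : ℂ :=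
  if evenPoint γ = evenSite R 0 0 then 1 else 0

theorem evenPoint_eq_origin_iff {R : Type} [CommRing R] (γ : R × R) :
    evenPoint γ = evenSite R 0 0 ↔ 2 * γ.1 = 0 ∧ 2 * γ.2 = 0 := by
  rw [evenSite_eq_evenPoint, Subtype.ext_iff, Prod.ext_iff]
  simp [evenPoint]

theorem unitSource_int (γ : ℤ × ℤ) : unitSource ℤ γ = if γ = 0 then 1 else 0 := by
  have h : evenPoint γ = evenSite ℤ 0 0 ↔ γ = 0 := by
    rw [evenPoint_eq_origin_iff, Prod.ext_iff]
    simp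
  simp only [unitSource, h]

theorem eventually_unitSource (γ : ℤ × ℤ) :
    ∀ᶠ T : ℕ+ in atTop, (unitSource (ZMod (2 * (T : ℕ))) ∘
      Prod.map (Int.castRingHom (ZMod (2 * (T : ℕ)))) (Int.castRingHom (ZMod (2 * (T : ℕ))))) γ =
      unitSource ℤ γ := by
  have key : ∀ᶠ T : ℕ+ in atTop, (((2 * γ.1 : ℤ) : ZMod (2 * (T : ℕ))) = 0 → γ.1 = 0) ∧
      (((2 * γ.2 : ℤ) : ZMod (2 * (T : ℕ))) = 0 → γ.2 = 0) := by
    have h : ∀ a : ℤ, ∀ᶠ T : ℕ+ in atTop, ((2 * a : ℤ) : ZMod (2 * (T : ℕ))) = 0 → a = 0 := by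
      intro a
      by_cases ha : a = 0
      · exact Eventually.of_forall fun _ _ => ha
      · filter_upwards [eventually_intCast_ne_zero (a := 2 * a) (by omega)] with T hT h
        exact absurd h hT
    exact (h _).and (h _)
  filter_upwards [key] with T hT
  have hiff : evenPoint (Prod.map (Int.castRingHom (ZMod (2 * (T : ℕ))))
      (Int.castRingHom (ZMod (2 * (T : ℕ)))) γ) = evenSite _ 0 0 ↔
      evenPoint γ = evenSite ℤ 0 0 := by
    rw [evenPoint_eq_origin_iff, evenPoint_eq_origin_iff]
    simp only [Prod.map_fst, Prod.map_snd, eq_intCast]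
    push_cast at hT
    constructor
    · rintro ⟨h1, h2⟩
      rw [hT.1 h1, hT.2 h2]
      simp
    · rintro ⟨h1, h2⟩
      have e1 : γ.1 = 0 := by omega
      have e2 : γ.2 = 0 := by omega
      simp [e1, e2]
  simp only [Function.comp_apply, unitSource]
  by_cases h : evenPoint γ = evenSite ℤ 0 0
  · rw [if_pos h, if_pos (hiff.mpr h)]
  · rw [if_neg h, if_neg (mt hiff.mp h)]

theorem zmod_two_mul_eq_zero {T : ℕ} [NeZero T] {a : ZMod (2 * T)} (h : 2 * a = 0) :
    a = 0 ∨ a = (T : ZMod (2 * T)) := by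
  have h1 : ((2 * a.val : ℕ) : ZMod (2 * T)) = 0 := by
    push_cast
    rw [ZMod.natCast_zmod_val, h]
  rw [ZMod.natCast_eq_zero_iff] at h1
  have h2 : T ∣ a.val := Nat.dvd_of_mul_dvd_mul_left two_pos h1
  have h3 := ZMod.val_lt a
  obtain ⟨k, hk⟩ := h2
  have hT : 0 < T := Nat.pos_of_ne_zero (NeZero.ne T)
  have hk2 : k < 2 := by
    rw [hk, mul_comm] at h3
    exact Nat.lt_of_mul_lt_mul_right h3
  have ha : ((a.val : ℕ) : ZMod (2 * T)) = a := ZMod.natCast_zmod_val a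
  interval_cases k
  · left
    rw [← ha, hk]
    simp
  · right
    rw [← ha, hk, mul_one]

/-- Doubling is two-to-one on each coordinate modulo $2T$, so the parametrization by `evenPoint`
covers the even points of the torus four times. The source therefore sits at four parameters, with
coordinates 0 or $T$. -/
theorem tsum_unitSource_le (T : ℕ) [NeZero T] :
    ∑' γ, ‖unitSource (ZMod (2 * T)) γ‖ ^ 2 ≤ 4 := by
  classical
  rw [tsum_fintype]
  have h1 : ∀ γ : ZMod (2 * T) × ZMod (2 * T), ‖unitSource (ZMod (2 * T)) γ‖ ^ 2 ≤
      if γ ∈ ({0, (T : ZMod (2 * T))} ×ˢ {0, (T : ZMod (2 * T))} :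
        Finset (ZMod (2 * T) × ZMod (2 * T))) then 1 else 0 := by
    intro γ
    by_cases h : evenPoint γ = evenSite (ZMod (2 * T)) 0 0
    · have h2 := (evenPoint_eq_origin_iff γ).mp h
      have hm : γ ∈ ({0, (T : ZMod (2 * T))} ×ˢ {0, (T : ZMod (2 * T))} :
          Finset (ZMod (2 * T) × ZMod (2 * T))) := by
        rw [Finset.mem_product]
        exact ⟨by simpa using zmod_two_mul_eq_zero h2.1, by simpa using zmod_two_mul_eq_zero h2.2⟩
      rw [if_pos hm, unitSource, if_pos h]
      simp
    · rw [unitSource, if_neg h]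
      simp only [norm_zero, ne_eq, OfNat.ofNat_ne_zero, not_false_eq_true, zero_pow]
      split_ifs <;> simp
  refine (Finset.sum_le_sum fun γ _ => h1 γ).trans ?_
  rw [Finset.sum_ite_mem, Finset.univ_inter, Finset.sum_const, nsmul_eq_mul, mul_one,
    Finset.card_product]
  have h2 : (({0, (T : ZMod (2 * T))} : Finset (ZMod (2 * T)))).card ≤ 2 := Finset.card_le_two
  exact_mod_cast Nat.mul_le_mul h2 h2

section Limit

variable {m ε δ : ℝ}

/-- The finite-lattice propagator to the edges starting at even points. -/
noncomputable def torusPropagator (T : ℕ) [NeZero T] (m ε δ : ℝ) (k : Dir)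
    (γ : ZMod (2 * T) × ZMod (2 * T)) : ℂ :=
  finitePropagator m ε δ (sourceEdge T) (evenPoint γ, k)

theorem isEvolution_torusPropagator (T : ℕ) [NeZero T] (hμ : 0 < m * ε) (h0 : 0 < δ)
    (h1 : δ < 1) :
    IsEvolution (stepNorm m ε δ) (m * ε) δ 1 (unitSource (ZMod (2 * T)))
      (torusPropagator T m ε δ .left) (torusPropagator T m ε δ .right) := by
  classical
  have h := (edgeEquation_finitePropagator hμ h0 h1 (sourceEdge T)).isEvolution
    (hasParity_zmod T) h0 h1 (by
      rintro p d (hp | rfl)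
      · refine if_neg fun h => hp ?_
        rw [show p = evenSite _ 0 0 from congrArg Prod.fst h, evenSite_eq_evenPoint]
        exact isEven_evenPoint _
      · exact if_neg fun h => by simpa [sourceEdge] using congrArg Prod.snd h)
  have hs : (fun γ => if (evenPoint γ, Dir.right) = sourceEdge T then (1 : ℂ) else 0) =
      unitSource (ZMod (2 * T)) := by
    funext γ
    have hiff : (evenPoint γ, Dir.right) = sourceEdge T ↔
        evenPoint γ = evenSite (ZMod (2 * T)) 0 0 := by
      rw [sourceEdge, Prod.mk.injEq]
      simp
    rw [unitSource]
    by_cases h : evenPoint γ = evenSite (ZMod (2 * T)) 0 0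
    · rw [if_pos h, if_pos (hiff.mpr h)]
    · rw [if_neg h, if_neg (mt hiff.mp h)]
  rw [← hs]
  exact h

/-- The constants of the energy estimate and the norm of the source do not depend on $T$. -/
theorem exists_sum_torusPropagator_le (hμ : 0 < m * ε) (h0 : 0 < δ) (h1 : δ < 1) :
    ∃ C : ℝ, ∀ (k : Dir) (T : ℕ+), ∑' γ, ‖torusPropagator (T : ℕ) m ε δ k γ‖ ^ 2 ≤ C := by
  have hb : 0 < 4 * (m * ε * δ) ^ 2 := by positivity
  have key : ∀ {x a b c : ℝ}, 0 ≤ a → b ≤ 4 → 4 * (m * ε * δ) ^ 2 * x ≤ a * b → a ≤ c →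
      x ≤ c * 4 / (4 * (m * ε * δ) ^ 2) := by
    intro x a b c ha hb4 hx hc
    rw [le_div_iff₀ hb]
    nlinarith
  refine ⟨max (2 * ((m * ε) ^ 2 + δ ^ 2)) (3 * (stepNorm m ε δ ^ 2 + 1 + (m * ε * δ) ^ 2)) * 4 /
    (4 * (m * ε * δ) ^ 2), fun k T => ?_⟩
  have hev := isEvolution_torusPropagator (T : ℕ) hμ h0 h1
  have hs := tsum_unitSource_le (T : ℕ)
  cases k
  · exact key (by positivity) hs (hev.tsum_fst_le (stepNorm_sq h0 h1) (stepNorm_pos h0 h1).ne'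
      (Or.inl rfl) (mul_pos hμ h0) (hasSum_fintype _).summable (hasSum_fintype _).summable)
      (le_max_left _ _)
  · exact key (by positivity) hs (hev.tsum_snd_le (stepNorm_sq h0 h1) (stepNorm_pos h0 h1).ne'
      (Or.inl rfl) (mul_pos hμ h0) (hasSum_fintype _).summable (hasSum_fintype _).summable)
      (le_max_right _ _)

/-- The finite-lattice propagator as a function on the infinite lattice. -/
noncomputable def liftedPropagator (T : ℕ) [NeZero T] (m ε δ : ℝ) (k : Dir) : ℤ × ℤ → ℂ :=
  torusPropagator T m ε δ k ∘
    Prod.map (Int.castRingHom (ZMod (2 * T))) (Int.castRingHom (ZMod (2 * T)))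

theorem isEvolution_liftedPropagator (T : ℕ) [NeZero T] (hμ : 0 < m * ε) (h0 : 0 < δ)
    (h1 : δ < 1) :
    IsEvolution (stepNorm m ε δ) (m * ε) δ 1 (unitSource (ZMod (2 * T)) ∘
      Prod.map (Int.castRingHom (ZMod (2 * T))) (Int.castRingHom (ZMod (2 * T))))
      (liftedPropagator T m ε δ .left) (liftedPropagator T m ε δ .right) := by
  refine IsEvolution.comp _ ?_
  rw [map_one]
  exact isEvolution_torusPropagator T hμ h0 h1

/-- Compactness and uniqueness: limits along ultrafilters exist by the uniform bound, inherit the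
evolution and square-summability, and hence all equal the given solution. -/
theorem tendsto_liftedPropagator (hμ : 0 < m * ε) (h0 : 0 < δ) (h1 : δ < 1)
    {u v : ℤ × ℤ → ℂ} (huv : IsEvolution (stepNorm m ε δ) (m * ε) δ 1 (unitSource ℤ) u v)
    (hu : Summable fun γ => ‖u γ‖ ^ 2) (hv : Summable fun γ => ‖v γ‖ ^ 2) (γ : ℤ × ℤ) :
    Tendsto (fun T : ℕ+ => liftedPropagator (T : ℕ) m ε δ .left γ) atTop (𝓝 (u γ)) ∧
    Tendsto (fun T : ℕ+ => liftedPropagator (T : ℕ) m ε δ .right γ) atTop (𝓝 (v γ)) := by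
  obtain ⟨C, hC⟩ := exists_sum_torusPropagator_le hμ h0 h1
  have hsum : ∀ (k : Dir) (F : Finset (ℤ × ℤ)), ∀ᶠ T : ℕ+ in atTop,
      ∑ γ ∈ F, ‖liftedPropagator (T : ℕ) m ε δ k γ‖ ^ 2 ≤ C := by
    intro k F
    filter_upwards [eventually_intCast_injOn F] with T hT
    refine le_trans ?_ (hC k T)
    classical
    have h2 := Finset.sum_image (f := fun γ => ‖torusPropagator (T : ℕ) m ε δ k γ‖ ^ 2) hT
    rw [tsum_fintype]
    refine (le_of_eq ?_).trans (Finset.sum_le_sum_of_subset_of_nonneg (Finset.subset_univ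
      (F.image (Prod.map (Int.castRingHom (ZMod (2 * (T : ℕ))))
      (Int.castRingHom (ZMod (2 * (T : ℕ))))))) fun _ _ _ => sq_nonneg _)
    rw [h2]
    rfl
  have hbd : ∀ (k : Dir) (γ : ℤ × ℤ), ∀ᶠ T : ℕ+ in atTop,
      liftedPropagator (T : ℕ) m ε δ k γ ∈ Metric.closedBall (0 : ℂ) (√C) := by
    intro k γ
    filter_upwards [hsum k {γ}] with T hT
    rw [Finset.sum_singleton] at hT
    rw [mem_closedBall_zero_iff]
    exact Real.le_sqrt_of_sq_le hT
  have hlim : ∀ 𝒰 : Ultrafilter ℕ+, (𝒰 : Filter ℕ+) ≤ atTop →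
      ∃ L : Dir → ℤ × ℤ → ℂ, (∀ k γ, Tendsto (fun T : ℕ+ => liftedPropagator (T : ℕ) m ε δ k γ) 𝒰
        (𝓝 (L k γ))) ∧ L .left = u ∧ L .right = v := by
    intro 𝒰 h𝒰
    have hex : ∀ k γ, ∃ z, Tendsto (fun T : ℕ+ => liftedPropagator (T : ℕ) m ε δ k γ) 𝒰 (𝓝 z) := by
      intro k γ
      have h3 := (isCompact_closedBall (0 : ℂ) (√C)).ultrafilter_le_nhds
        (𝒰.map fun T : ℕ+ => liftedPropagator (T : ℕ) m ε δ k γ)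
        (le_principal_iff.mpr (h𝒰 (hbd k γ)))
      obtain ⟨z, -, hz⟩ := h3
      exact ⟨z, hz⟩
    choose L hL using hex
    refine ⟨L, hL, ?_⟩
    have hLs : ∀ k, Summable fun γ => ‖L k γ‖ ^ 2 := by
      intro k
      refine summable_of_sum_le (c := C) (fun _ => sq_nonneg _) fun F => ?_
      refine le_of_tendsto (tendsto_finsetSum F fun γ _ => ((hL k γ).norm.pow 2)) ?_
      exact h𝒰 (hsum k F)
    have hLev : IsEvolution (stepNorm m ε δ) (m * ε) δ 1 (unitSource ℤ) (L .left) (L .right) := by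
      refine ⟨fun n j => ?_, fun n j => ?_⟩
      · refine tendsto_nhds_unique ((hL .left (n, j + 1)).const_mul _)
          (((((hL .left (n + 1, j)).add ((hL .left (n, j)).const_mul _)).sub
            ((hL .right (n, j)).const_mul _)).sub ((hL .right (n - 1, j)).const_mul _)).congr
            fun T => ((isEvolution_liftedPropagator (T : ℕ) hμ h0 h1).fst n j).symm)
      · refine tendsto_nhds_unique ((hL .right (n, j + 1)).const_mul _)
          ((((((hL .right (n - 1, j)).add ((hL .right (n, j)).const_mul _)).sub
            ((hL .left (n, j)).const_mul _)).sub
            ((hL .left (n + 1, j)).const_mul _)).add_const _).congr' ?_)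
        filter_upwards [h𝒰 (eventually_unitSource (n, j + 1))] with T hT
        rw [← hT]
        exact ((isEvolution_liftedPropagator (T : ℕ) hμ h0 h1).snd n j).symm
    exact hLev.unique huv (stepNorm_sq h0 h1) (stepNorm_pos h0 h1).ne' (Or.inl rfl)
      (mul_pos hμ h0) (hLs _) (hLs _) hu hv
  constructor <;> rw [tendsto_iff_ultrafilter] <;> intro 𝒰 h𝒰
  · obtain ⟨L, hL, rfl, -⟩ := hlim 𝒰 h𝒰
    exact hL _ _
  · obtain ⟨L, hL, -, rfl⟩ := hlim 𝒰 h𝒰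
    exact hL _ _

end Limit

/-! ### The Green function of the scalar equation -/

section Green

open Complex MeasureTheory

/-- Half of the trace of the evolution symbol. -/
noncomputable def symbolCos (κ β x : ℝ) : ℂ := (Real.cos x + β * I) / κ

/-- The square root of `1 - symbolCos ^ 2` with positive real part. -/
noncomputable def symbolSin (κ β x : ℝ) : ℂ := (1 - symbolCos κ β x ^ 2) ^ (2⁻¹ : ℂ)

/-- The small eigenvalue of the evolution symbol. -/
noncomputable def symbolRoot (κ β x : ℝ) : ℂ := symbolCos κ β x - I * symbolSin κ β x

/-- The Fourier transform of the Green function in the space variable. -/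
noncomputable def greenSymbol (κ β : ℝ) (j : ℤ) (x : ℝ) : ℂ :=
  I * symbolRoot κ β x ^ j.natAbs / (2 * symbolSin κ β x)

/-- The Green function of the scalar equation. -/
noncomputable def green (κ β : ℝ) (γ : ℤ × ℤ) : ℂ :=
  1 / (2 * Real.pi) * ∫ x in (0 : ℝ)..(2 * Real.pi), exp (-(γ.1 * x * I)) * greenSymbol κ β γ.2 x

/-- The parameters for which the Green function is well-defined. -/
def greenDomain : Set (ℝ × ℝ) := {q | 0 < q.1 ∧ 0 ≤ q.2 ∧ (0 < q.2 ∨ 1 < q.1)}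

variable {κ β : ℝ}

/-- Where the imaginary part vanishes, either $\cos x=0$, or $\beta=0$ and $\kappa>1$; in both cases
the real part is positive. So the principal square root is continuous on the whole domain, including
$\beta=0$, $\kappa>1$. -/
theorem one_sub_symbolCos_sq_mem (h : (κ, β) ∈ greenDomain) (x : ℝ) :
    1 - symbolCos κ β x ^ 2 ∈ slitPlane := by
  obtain ⟨hκ, hβ, hor⟩ := h
  simp only at hκ hβ hor
  have hre : (1 - symbolCos κ β x ^ 2).re = 1 - (Real.cos x ^ 2 - β ^ 2) / κ ^ 2 := by
    rw [symbolCos, div_pow, ← ofReal_pow, sub_re, div_ofReal_re, sq]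
    generalize Real.cos x = c
    simp
    ring
  have him : (1 - symbolCos κ β x ^ 2).im = -(2 * Real.cos x * β) / κ ^ 2 := by
    rw [symbolCos, div_pow, ← ofReal_pow, sub_im, div_ofReal_im, sq]
    generalize Real.cos x = c
    simp
    ring
  rw [mem_slitPlane_iff, hre, him]
  by_cases hc : Real.cos x * β = 0
  · left
    rw [sub_pos, div_lt_one (by positivity)]
    rcases mul_eq_zero.mp hc with h0 | h0
    · rw [h0]
      nlinarith [sq_nonneg β]
    · have h1 : 1 < κ := hor.resolve_left (by simp [h0])
      nlinarith [Real.cos_sq_le_one x, sq_nonneg β]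
  · right
    intro h0
    rw [div_eq_zero_iff] at h0
    rcases h0 with h0 | h0
    · exact hc (by linarith)
    · exact absurd h0 (by positivity)

theorem symbolSin_sq (κ β x : ℝ) : symbolSin κ β x ^ 2 = 1 - symbolCos κ β x ^ 2 :=
  cpow_ofNat_inv_pow _ 2

theorem symbolSin_re_pos (h : (κ, β) ∈ greenDomain) (x : ℝ) : 0 < (symbolSin κ β x).re := by
  have hm := one_sub_symbolCos_sq_mem h x
  set z := 1 - symbolCos κ β x ^ 2 with hz
  rw [symbolSin, ← hz, cpow_inv_two_re]
  refine Real.sqrt_pos.mpr (half_pos ?_)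
  rcases mem_slitPlane_iff.mp hm with h1 | h1
  · positivity
  · have h2 : |z.re| < ‖z‖ := abs_re_lt_norm.mpr h1
    have := neg_abs_le z.re
    linarith

theorem symbolSin_ne_zero (h : (κ, β) ∈ greenDomain) (x : ℝ) : symbolSin κ β x ≠ 0 := fun h0 => by
  have := symbolSin_re_pos h x
  simp [h0] at this

theorem symbolRoot_sq (κ β x : ℝ) :
    symbolRoot κ β x ^ 2 - 2 * symbolCos κ β x * symbolRoot κ β x + 1 = 0 := by
  have h := symbolSin_sq κ β x
  rw [symbolRoot]
  linear_combination -h + symbolSin κ β x ^ 2 * I_sq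

/-- Write $w$, $q$ for the symbol cosine and sine. The eigenvalues $w\mp iq$ have product 1, so it
suffices to compare their moduli. The sign of the difference follows from $\operatorname{Re}q>0$,
$\operatorname{Im}w>0$ and
$\operatorname{Re}q\operatorname{Im}q=-\operatorname{Re}w\operatorname{Im}w$. -/
theorem norm_symbolRoot_lt (hκ : 0 < κ) (hβ : 0 < β) (x : ℝ) : ‖symbolRoot κ β x‖ < 1 := by
  have hq := symbolSin_re_pos (κ := κ) (β := β) ⟨hκ, hβ.le, Or.inl hβ⟩ x
  have hsq := symbolSin_sq κ β x
  set q := symbolSin κ β x with hqd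
  set w := symbolCos κ β x with hwd
  have hw : 0 < w.im := by
    rw [hwd, symbolCos, div_ofReal_im]
    simp only [add_im, ofReal_im, mul_im, ofReal_re, I_im, mul_one, I_re, mul_zero, add_zero,
      zero_add]
    positivity
  have him : q.re * q.im = -(w.re * w.im) := by
    have := congrArg Complex.im hsq
    simp only [sq, mul_im, sub_im, one_im] at this
    linarith
  have hprod : (w - I * q) * (w + I * q) = 1 := by
    linear_combination hsq - q ^ 2 * I_sq
  have hlt : normSq (w - I * q) < normSq (w + I * q) := by
    have h1 : normSq (w + I * q) - normSq (w - I * q) = 4 * (w.im * q.re - w.re * q.im) := by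
      simp [normSq_apply]
      ring
    have h2 : 0 < (w.im * q.re - w.re * q.im) * q.re := by
      have : (w.im * q.re - w.re * q.im) * q.re = w.im * q.re ^ 2 + w.re ^ 2 * w.im := by
        linear_combination (-w.re) * him
      rw [this]
      positivity
    have h3 := (pos_iff_pos_of_mul_pos h2).mpr hq
    linarith
  have hn : normSq (w - I * q) * normSq (w + I * q) = 1 := by
    rw [← normSq_mul, hprod, normSq_one]
  have hlt1 : normSq (w - I * q) < 1 := by
    by_contra hge
    push Not at hge
    nlinarith [normSq_nonneg (w - I * q)]
  rw [normSq_eq_norm_sq] at hlt1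
  change ‖w - I * q‖ < 1
  nlinarith [norm_nonneg (w - I * q)]

/-- Away from $j=0$ this is the quadratic equation for the eigenvalue; at $j=0$ the jump caused by
$|j|$ produces the source. -/
theorem greenSymbol_equation (h : (κ, β) ∈ greenDomain) (j : ℤ) (x : ℝ) :
    κ * (greenSymbol κ β (j + 1) x + greenSymbol κ β (j - 1) x) -
      (2 * Real.cos x + 2 * I * β) * greenSymbol κ β j x = if j = 0 then (κ : ℂ) else 0 := by
  have hq := symbolSin_ne_zero h x
  have hκ : (κ : ℂ) ≠ 0 := by exact_mod_cast h.1.ne'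
  have hw : (2 * Real.cos x + 2 * I * β : ℂ) = 2 * κ * symbolCos κ β x := by
    rw [symbolCos]
    field_simp
  have hr := symbolRoot_sq κ β x
  rw [hw]
  simp only [greenSymbol]
  set w := symbolCos κ β x
  rcases lt_trichotomy j 0 with hj | rfl | hj
  · obtain ⟨k, rfl⟩ : ∃ k : ℕ, j = -(k + 1 : ℤ) := ⟨(-j - 1).toNat, by omega⟩
    have e1 : (-(k + 1 : ℤ) + 1).natAbs = k := by omega
    have e2 : (-(k + 1 : ℤ) - 1).natAbs = k + 2 := by omega
    have e3 : (-(k + 1 : ℤ)).natAbs = k + 1 := by omega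
    rw [e1, e2, e3, if_neg (by omega)]
    field_simp
    linear_combination κ * I * symbolRoot κ β x ^ k * hr
  · simp only [zero_add, Int.natAbs_one, zero_sub, Int.natAbs_neg, Int.natAbs_zero, pow_one,
      pow_zero, if_true]
    have hd : symbolRoot κ β x = w - I * symbolSin κ β x := rfl
    field_simp
    rw [hd]
    linear_combination -2 * symbolSin κ β x * I_sq
  · obtain ⟨k, rfl⟩ : ∃ k : ℕ, j = (k + 1 : ℤ) := ⟨(j - 1).toNat, by omega⟩
    have e1 : ((k + 1 : ℤ) + 1).natAbs = k + 2 := by omega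
    have e2 : ((k + 1 : ℤ) - 1).natAbs = k := by omega
    have e3 : ((k + 1 : ℤ)).natAbs = k + 1 := by omega
    rw [e1, e2, e3, if_neg (by omega)]
    field_simp
    linear_combination κ * I * symbolRoot κ β x ^ k * hr

theorem continuous_greenSymbol_uncurry (j : ℤ) :
    Continuous fun p : greenDomain × ℝ => greenSymbol p.1.1.1 p.1.1.2 j p.2 := by
  have hw : Continuous fun p : greenDomain × ℝ => symbolCos p.1.1.1 p.1.1.2 p.2 := by
    unfold symbolCos
    refine Continuous.div (by fun_prop) (by fun_prop) fun p => ?_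
    exact_mod_cast p.1.2.1.ne'
  have hq : Continuous fun p : greenDomain × ℝ => symbolSin p.1.1.1 p.1.1.2 p.2 := by
    unfold symbolSin
    exact Continuous.cpow (by fun_prop) continuous_const fun p =>
      one_sub_symbolCos_sq_mem p.1.2 p.2
  unfold greenSymbol symbolRoot
  refine Continuous.div (by fun_prop) (by fun_prop) fun p => ?_
  exact mul_ne_zero two_ne_zero (symbolSin_ne_zero p.1.2 p.2)

theorem continuous_greenSymbol (h : (κ, β) ∈ greenDomain) (j : ℤ) :
    Continuous (greenSymbol κ β j) := by
  have h2 : Continuous fun x : ℝ => ((⟨(κ, β), h⟩ : greenDomain), x) := by fun_prop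
  have h3 := (continuous_greenSymbol_uncurry j).comp h2
  exact h3

theorem continuousOn_green (γ : ℤ × ℤ) :
    ContinuousOn (fun q : ℝ × ℝ => green q.1 q.2 γ) greenDomain := by
  rw [continuousOn_iff_continuous_domRestrict]
  refine Continuous.mul continuous_const ?_
  refine intervalIntegral.continuous_parametric_intervalIntegral_of_continuous'
    (f := fun (q : greenDomain) (x : ℝ) => exp (-(γ.1 * x * I)) * greenSymbol q.1.1 q.1.2 γ.2 x)
    ?_ _ _
  refine Continuous.mul (by fun_prop) (continuous_greenSymbol_uncurry γ.2)

theorem integral_exp_int (n : ℤ) :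
    ∫ x in (0 : ℝ)..(2 * Real.pi), exp (-(n * x * I)) = if n = 0 then 2 * (Real.pi : ℂ) else 0 := by
  split_ifs with hn
  · simp [hn]
  · have hc : -(n * I) ≠ 0 := neg_ne_zero.mpr (mul_ne_zero (by exact_mod_cast hn) I_ne_zero)
    have h := integral_exp_mul_complex (a := 0) (b := 2 * Real.pi) hc
    have e : ∀ x : ℝ, -((n : ℂ) * x * I) = -(n * I) * x := fun x => by ring
    simp only [e]
    rw [h]
    have h2 : -(n * I) * ((2 * Real.pi : ℝ) : ℂ) = ((-n : ℤ) : ℂ) * (2 * Real.pi * I) := by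
      push_cast
      ring
    rw [h2, exp_int_mul_two_pi_mul_I]
    simp

/-- A shift in $n$ multiplies the Fourier integrand by $e^{\mp ix}$, so the equation is the
integrated form of `greenSymbol_equation`. -/
theorem green_equation (h : (κ, β) ∈ greenDomain) (n j : ℤ) :
    κ * (green κ β (n, j + 1) + green κ β (n, j - 1)) - green κ β (n + 1, j) -
      green κ β (n - 1, j) - 2 * I * β * green κ β (n, j) =
      if n = 0 ∧ j = 0 then (κ : ℂ) else 0 := by
  have hint : ∀ (n j : ℤ), IntervalIntegrable (fun x : ℝ => exp (-(n * x * I)) *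
      greenSymbol κ β j x) volume 0 (2 * Real.pi) := fun n j =>
    (Continuous.mul (by fun_prop) (continuous_greenSymbol h j)).intervalIntegrable _ _
  have hpi : (Real.pi : ℂ) ≠ 0 := by exact_mod_cast Real.pi_ne_zero
  have key : κ * ((∫ x in (0 : ℝ)..(2 * Real.pi), exp (-(n * x * I)) * greenSymbol κ β (j + 1) x) +
      ∫ x in (0 : ℝ)..(2 * Real.pi), exp (-(n * x * I)) * greenSymbol κ β (j - 1) x) -
      (∫ x in (0 : ℝ)..(2 * Real.pi), exp (-((n + 1 : ℤ) * x * I)) * greenSymbol κ β j x) -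
      (∫ x in (0 : ℝ)..(2 * Real.pi), exp (-((n - 1 : ℤ) * x * I)) * greenSymbol κ β j x) -
      2 * I * β * (∫ x in (0 : ℝ)..(2 * Real.pi), exp (-(n * x * I)) * greenSymbol κ β j x) =
      ∫ x in (0 : ℝ)..(2 * Real.pi), exp (-(n * x * I)) * (if j = 0 then (κ : ℂ) else 0) := by
    rw [← intervalIntegral.integral_add (hint _ _) (hint _ _),
      ← intervalIntegral.integral_const_mul, ← intervalIntegral.integral_const_mul,
      ← intervalIntegral.integral_sub (((hint _ _).add (hint _ _)).const_mul _) (hint _ _),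
      ← intervalIntegral.integral_sub
        ((((hint _ _).add (hint _ _)).const_mul _).sub (hint _ _)) (hint _ _),
      ← intervalIntegral.integral_sub
        (((((hint _ _).add (hint _ _)).const_mul _).sub (hint _ _)).sub (hint _ _))
        ((hint _ _).const_mul _)]
    refine intervalIntegral.integral_congr fun x _ => ?_
    rw [← greenSymbol_equation h j x]
    have e1 : exp (-((n + 1 : ℤ) * x * I)) = exp (-(n * x * I)) * exp (-(x * I)) := by
      rw [← exp_add]
      push_cast
      ring_nf
    have e2 : exp (-((n - 1 : ℤ) * x * I)) = exp (-(n * x * I)) * exp (x * I) := by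
      rw [← exp_add]
      push_cast
      ring_nf
    have e3 : (2 * Real.cos x : ℂ) = exp (x * I) + exp (-(x * I)) := by
      rw [ofReal_cos, two_cos, neg_mul]
    rw [e1, e2, e3]
    ring
  rw [intervalIntegral.integral_mul_const, integral_exp_int] at key
  simp only [green]
  have hfin : (1 / (2 * (Real.pi : ℂ))) * ((if n = 0 then 2 * (Real.pi : ℂ) else 0) *
      (if j = 0 then (κ : ℂ) else 0)) = if n = 0 ∧ j = 0 then (κ : ℂ) else 0 := by
    by_cases hn : n = 0 <;> by_cases hj : j = 0 <;> simp [hn, hj]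
    field_simp
  rw [← hfin, ← key]
  ring

/-- Parseval's identity in the space variable. -/
theorem hasSum_green_sq (h : (κ, β) ∈ greenDomain) (j : ℤ) :
    HasSum (fun n : ℤ => ‖green κ β (n, j)‖ ^ 2)
      ((2 * Real.pi)⁻¹ * ∫ x in (0 : ℝ)..(2 * Real.pi), ‖greenSymbol κ β j x‖ ^ 2) := by
  have hc := continuous_greenSymbol h j
  obtain ⟨C, hC⟩ := (isCompact_Icc (a := (0 : ℝ)) (b := 2 * Real.pi)).exists_bound_of_continuousOn
    hc.continuousOn
  have hL : MemLp (greenSymbol κ β j) 2 (volume.restrict (Set.Ioc 0 (2 * Real.pi))) := by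
    refine MemLp.of_bound hc.aestronglyMeasurable C ?_
    rw [ae_restrict_iff' measurableSet_Ioc]
    exact Eventually.of_forall fun x hx => hC x ⟨hx.1.le, hx.2⟩
  have h2 := hasSum_sq_fourierCoeffOn Real.two_pi_pos hL
  rw [sub_zero, smul_eq_mul] at h2
  convert h2 using 3 with n
  rw [fourierCoeffOn_eq_integral, green, sub_zero]
  rw [Complex.real_smul]
  push_cast
  congr 3
  funext x
  rw [fourier_coe_apply, smul_eq_mul]
  have hpi : (Real.pi : ℂ) ≠ 0 := by exact_mod_cast Real.pi_ne_zero
  congr 2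
  push_cast
  field_simp

/-- Parseval reduces the sum over $n$ to an integral that decays geometrically in $|j|$, because the
modulus of the eigenvalue is bounded by some $\rho<1$ by compactness. -/
theorem summable_green_sq (hκ : 0 < κ) (hβ : 0 < β) :
    Summable fun γ : ℤ × ℤ => ‖green κ β γ‖ ^ 2 := by
  have h : (κ, β) ∈ greenDomain := ⟨hκ, hβ.le, Or.inl hβ⟩
  have hcr : Continuous fun x => ‖symbolRoot κ β x‖ := by
    have h1 : Continuous (greenSymbol κ β 1) := continuous_greenSymbol h 1
    have h0 : Continuous (greenSymbol κ β 0) := continuous_greenSymbol h 0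
    have h3 : ∀ x, greenSymbol κ β 0 x ≠ 0 := fun x =>
      div_ne_zero (mul_ne_zero I_ne_zero (by simp))
        (mul_ne_zero two_ne_zero (symbolSin_ne_zero h x))
    -- The eigenvalue is the ratio of two consecutive Green symbols, which gives its continuity.
    have h2 : (fun x => ‖symbolRoot κ β x‖) =
        fun x => ‖greenSymbol κ β 1 x / greenSymbol κ β 0 x‖ := by
      funext x
      have := symbolSin_ne_zero h x
      simp only [greenSymbol, Int.natAbs_one, Int.natAbs_zero, pow_one, pow_zero, mul_one]
      congr 1
      field_simp
    rw [h2]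
    exact (h1.div h0 h3).norm
  obtain ⟨x0, -, hx0⟩ := (isCompact_Icc (a := (0 : ℝ)) (b := 2 * Real.pi)).exists_isMaxOn
    (Set.nonempty_Icc.mpr Real.two_pi_pos.le) hcr.continuousOn
  set ρ := ‖symbolRoot κ β x0‖ with hρ
  have hρ0 : 0 ≤ ρ := norm_nonneg _
  have hρ1 : ρ < 1 := norm_symbolRoot_lt hκ hβ x0
  obtain ⟨M, hM⟩ := (isCompact_Icc (a := (0 : ℝ)) (b := 2 * Real.pi)).exists_bound_of_continuousOn
    (continuous_greenSymbol h 0).continuousOn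
  have hM0 : 0 ≤ M := (norm_nonneg _).trans (hM 0 ⟨le_rfl, Real.two_pi_pos.le⟩)
  have hbd : ∀ j : ℤ, ∀ x ∈ Set.Icc (0 : ℝ) (2 * Real.pi),
      ‖greenSymbol κ β j x‖ ^ 2 ≤ M ^ 2 * (ρ ^ 2) ^ j.natAbs := by
    intro j x hx
    have h1 : greenSymbol κ β j x = greenSymbol κ β 0 x * symbolRoot κ β x ^ j.natAbs := by
      simp only [greenSymbol, Int.natAbs_zero, pow_zero, mul_one]
      ring
    rw [h1, norm_mul, norm_pow, mul_pow, ← pow_mul, mul_comm j.natAbs, pow_mul]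
    have h2 : ‖symbolRoot κ β x‖ ≤ ρ := hx0 hx
    gcongr
    exact hM x hx
  have hj : ∀ j : ℤ, ∑' n : ℤ, ‖green κ β (n, j)‖ ^ 2 ≤ M ^ 2 * (ρ ^ 2) ^ j.natAbs := by
    intro j
    rw [(hasSum_green_sq h j).tsum_eq, inv_mul_le_iff₀ Real.two_pi_pos]
    have hi := intervalIntegral.integral_mono_on Real.two_pi_pos.le
      (((continuous_greenSymbol h j).norm.pow 2).intervalIntegrable _ _)
      (continuous_const.intervalIntegrable (μ := volume) _ _) (hbd j)
    rw [mul_left_comm]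
    simpa using hi
  have hgeo : Summable fun j : ℤ => M ^ 2 * (ρ ^ 2) ^ j.natAbs := by
    have hg : Summable fun k : ℕ => (ρ ^ 2) ^ k :=
      summable_geometric_of_lt_one (by positivity) (by nlinarith)
    refine Summable.mul_left _ (Summable.of_nat_of_neg ?_ ?_) <;> simpa using hg
  have hsw : Summable fun p : ℤ × ℤ => ‖green κ β (p.2, p.1)‖ ^ 2 := by
    refine (summable_prod_of_nonneg fun _ => by positivity).mpr
      ⟨fun j => (hasSum_green_sq h j).summable, ?_⟩
    exact Summable.of_nonneg_of_le (fun j => tsum_nonneg fun _ => sq_nonneg _) hj hgeo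
  exact (Equiv.prodComm ℤ ℤ).summable_iff
    (f := fun p : ℤ × ℤ => ‖green κ β (p.2, p.1)‖ ^ 2) |>.mpr hsw

end Green

/-! ### The explicit solution of the two-component system -/

section Solution

variable (m ε : ℝ)

/-- The Green function with the parameters of the lattice. -/
noncomputable def latticeGreen (δ : ℝ) : ℤ × ℤ → ℂ := green (stepNorm m ε δ) (m * ε * δ)

/-- The first component of the square-summable solution with a source at the origin. -/
noncomputable def solutionFst (y : ℤ) (c : ℂ) (δ : ℝ) (γ : ℤ × ℤ) : ℂ :=
  c * (-Complex.I * (m * ε : ℝ) * latticeGreen m ε δ γ - δ * latticeGreen m ε δ (γ.1 - y, γ.2)) /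
    stepNorm m ε δ

/-- The second component of the square-summable solution with a source at the origin. -/
noncomputable def solutionSnd (c : ℂ) (δ : ℝ) (γ : ℤ × ℤ) : ℂ :=
  c * (latticeGreen m ε δ (γ.1, γ.2 + 1) - (latticeGreen m ε δ (γ.1 + 1, γ.2) +
    Complex.I * (m * ε : ℝ) * δ * latticeGreen m ε δ γ) / stepNorm m ε δ)

variable {m ε} {δ : ℝ}

theorem isEvolution_solution (hμ : 0 < m * ε) (h0 : 0 < δ) (h1 : δ < 1) {y : ℤ}
    (hy : y = 1 ∨ y = -1) (c : ℂ) :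
    IsEvolution (stepNorm m ε δ) (m * ε) δ y (fun γ => c * unitSource ℤ γ)
      (solutionFst m ε y c δ) (solutionSnd m ε c δ) := by
  have hκ := stepNorm_pos (m := m) (ε := ε) h0 h1
  refine IsEvolution.of_scalar (φ := latticeGreen m ε δ) c (stepNorm_sq h0 h1) hκ.ne' hy
    fun n j => ?_
  have h := green_equation (κ := stepNorm m ε δ) (β := m * ε * δ)
    ⟨hκ, (mul_pos hμ h0).le, Or.inl (mul_pos hμ h0)⟩ n j
  have hs : stepNorm m ε δ * unitSource ℤ (n, j) =
      if n = 0 ∧ j = 0 then (stepNorm m ε δ : ℂ) else 0 := by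
    rw [unitSource_int]
    simp [Prod.ext_iff]
  rw [hs, ← h]
  push_cast [latticeGreen]
  ring

theorem summable_latticeGreen (hμ : 0 < m * ε) (h0 : 0 < δ) (h1 : δ < 1) (a : ℤ × ℤ) (c : ℂ) :
    Summable fun γ : ℤ × ℤ => ‖c * latticeGreen m ε δ (γ + a)‖ ^ 2 := by
  have h := (summable_green_sq (stepNorm_pos (m := m) (ε := ε) h0 h1) (mul_pos hμ h0))
  have h2 := (Equiv.addRight a).summable_iff
    (f := fun γ => ‖green (stepNorm m ε δ) (m * ε * δ) γ‖ ^ 2) |>.mpr h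
  refine (h2.mul_left (‖c‖ ^ 2)).congr fun γ => ?_
  rw [norm_mul, mul_pow]
  rfl

theorem summable_solutionFst (hμ : 0 < m * ε) (h0 : 0 < δ) (h1 : δ < 1) (y : ℤ) (c : ℂ) :
    Summable fun γ => ‖solutionFst m ε y c δ γ‖ ^ 2 := by
  have h := IsEvolution.summable_sub
    (summable_latticeGreen hμ h0 h1 0 (c * (-Complex.I * (m * ε : ℝ)) / stepNorm m ε δ))
    (summable_latticeGreen hμ h0 h1 (-y, 0) (c * δ / stepNorm m ε δ))
  refine h.congr fun γ => ?_
  have e : γ + (-y, 0) = (γ.1 - y, γ.2) := by ext <;> simp [sub_eq_add_neg]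
  rw [Pi.sub_apply, solutionFst, add_zero, e]
  congr 2
  ring

theorem summable_solutionSnd (hμ : 0 < m * ε) (h0 : 0 < δ) (h1 : δ < 1) (c : ℂ) :
    Summable fun γ => ‖solutionSnd m ε c δ γ‖ ^ 2 := by
  have h := IsEvolution.summable_sub (IsEvolution.summable_sub
    (summable_latticeGreen hμ h0 h1 (0, 1) c)
    (summable_latticeGreen hμ h0 h1 (1, 0) (c / stepNorm m ε δ)))
    (summable_latticeGreen hμ h0 h1 0 (c * (Complex.I * (m * ε : ℝ) * δ) / stepNorm m ε δ))
  refine h.congr fun γ => ?_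
  have e1 : γ + (0, 1) = (γ.1, γ.2 + 1) := by ext <;> simp
  have e2 : γ + (1, 0) = (γ.1 + 1, γ.2) := by ext <;> simp
  rw [Pi.sub_apply, Pi.sub_apply, solutionSnd, add_zero, e1, e2]
  congr 2
  ring

theorem continuous_stepNorm (m ε : ℝ) : Continuous (stepNorm m ε) := by
  unfold stepNorm
  fun_prop

theorem one_lt_stepNorm_zero (hμ : 0 < m * ε) : 1 < stepNorm m ε 0 := by
  rw [stepNorm]
  simp only [ne_eq, OfNat.ofNat_ne_zero, not_false_eq_true, zero_pow, sub_zero, Real.sqrt_one,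
    mul_one]
  rw [Real.lt_sqrt (by norm_num)]
  nlinarith [mul_pos hμ hμ]

/-- The curve $\delta\mapsto(\kappa,\mu\delta)$ stays in the domain of continuity up to $\delta=0$,
since $\kappa=\sqrt{1+\mu^2}>1$ there. -/
theorem tendsto_latticeGreen (hμ : 0 < m * ε) (γ : ℤ × ℤ) :
    Tendsto (fun δ => latticeGreen m ε δ γ) (𝓝[>] 0) (𝓝 (latticeGreen m ε 0 γ)) := by
  have hmem : (stepNorm m ε 0, m * ε * 0) ∈ greenDomain := by
    have h1 := one_lt_stepNorm_zero hμ
    have h2 : 0 < stepNorm m ε 0 := zero_lt_one.trans h1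
    have h3 : 0 ≤ m * ε * 0 := (mul_zero _).ge
    simp only [greenDomain, Set.mem_ofPred_eq]
    exact ⟨h2, h3, Or.inr h1⟩
  have hgreen : Tendsto (fun q : ℝ × ℝ => green q.1 q.2 γ)
      (𝓝[greenDomain] (stepNorm m ε 0, m * ε * 0)) (𝓝 (green (stepNorm m ε 0) (m * ε * 0) γ)) :=
    continuousOn_green γ _ hmem
  have hpath : Tendsto (fun δ : ℝ => (stepNorm m ε δ, m * ε * δ)) (𝓝[>] 0)
      (𝓝[greenDomain] (stepNorm m ε 0, m * ε * 0)) := by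
    refine tendsto_nhdsWithin_iff.mpr ⟨?_, ?_⟩
    · have hc : Continuous fun δ : ℝ => (stepNorm m ε δ, m * ε * δ) :=
        (continuous_stepNorm m ε).prodMk (by fun_prop)
      exact (hc.tendsto 0).mono_left nhdsWithin_le_nhds
    · filter_upwards [Ioo_mem_nhdsGT (zero_lt_one (α := ℝ))] with δ hδ
      exact ⟨stepNorm_pos hδ.1 hδ.2, (mul_pos hμ hδ.1).le, Or.inl (mul_pos hμ hδ.1)⟩
  have h := hgreen.comp hpath
  simp only [latticeGreen]
  exact h

theorem tendsto_ofReal_zero : Tendsto (fun δ : ℝ => (δ : ℂ)) (𝓝[>] 0) (𝓝 ((0 : ℝ) : ℂ)) :=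
  (Complex.continuous_ofReal.tendsto 0).mono_left nhdsWithin_le_nhds

theorem tendsto_stepNorm :
    Tendsto (fun δ : ℝ => (stepNorm m ε δ : ℂ)) (𝓝[>] 0) (𝓝 (stepNorm m ε 0)) :=
  ((Complex.continuous_ofReal.comp (continuous_stepNorm m ε)).tendsto 0).mono_left
    nhdsWithin_le_nhds

theorem tendsto_solutionFst (hμ : 0 < m * ε) (y : ℤ) (c : ℂ) (γ : ℤ × ℤ) :
    Tendsto (fun δ => solutionFst m ε y c δ γ) (𝓝[>] 0) (𝓝 (solutionFst m ε y c 0 γ)) := by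
  have hκ : (stepNorm m ε 0 : ℂ) ≠ 0 := by
    exact_mod_cast (zero_lt_one.trans (one_lt_stepNorm_zero hμ)).ne'
  exact ((((tendsto_latticeGreen hμ γ).const_mul _).sub
    (tendsto_ofReal_zero.mul (tendsto_latticeGreen hμ _))).const_mul c).div tendsto_stepNorm hκ

theorem tendsto_solutionSnd (hμ : 0 < m * ε) (c : ℂ) (γ : ℤ × ℤ) :
    Tendsto (fun δ => solutionSnd m ε c δ γ) (𝓝[>] 0) (𝓝 (solutionSnd m ε c 0 γ)) := by
  have hκ : (stepNorm m ε 0 : ℂ) ≠ 0 := by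
    exact_mod_cast (zero_lt_one.trans (one_lt_stepNorm_zero hμ)).ne'
  exact ((tendsto_latticeGreen hμ _).sub (((tendsto_latticeGreen hμ _).add
    ((tendsto_ofReal_zero.const_mul _).mul (tendsto_latticeGreen hμ γ))).div
    tendsto_stepNorm hκ)).const_mul c

/-- The shift `y`, the only difference between the two evolutions apart from normalization, enters
with a factor $\delta$. -/
theorem solutionFst_zero (y y' : ℤ) (c : ℂ) (γ : ℤ × ℤ) :
    solutionFst m ε y c 0 γ = c * solutionFst m ε y' 1 0 γ := by
  simp only [solutionFst, Complex.ofReal_zero]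
  ring

theorem solutionSnd_smul (c : ℂ) (γ : ℤ × ℤ) :
    solutionSnd m ε c δ γ = c * solutionSnd m ε 1 δ γ := by
  simp only [solutionSnd]
  ring

end Solution

/-! ### The axiomatic propagator -/

section Axioms

variable {m ε δ : ℝ} {A : Dir → Site ℤ → ℂ}

open Classical in
theorem ite_two_eq_unitSource (γ : ℤ × ℤ) :
    (if evenPoint γ = evenSite ℤ 0 0 then (2 : ℂ) else 0) = 2 * unitSource ℤ γ := by
  rw [unitSource]
  by_cases h : evenPoint γ = evenSite ℤ 0 0
  · rw [if_pos h, if_pos h, mul_one]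
  · rw [if_neg h, if_neg h, mul_zero]

/-- The factor $-i$ on the first function turns the real rotation by $\pm m\varepsilon$ into the
symmetric coupling $-i\mu$. The turns occur here before the step rather than after it, whence
$y=-1$. -/
theorem SatisfiesAxioms.isEvolution (h : SatisfiesAxioms m ε δ A) (h0 : 0 < δ) (h1 : δ < 1) :
    IsEvolution (stepNorm m ε δ) (m * ε) δ (-1) (fun γ => 2 * unitSource ℤ γ)
      (fun γ => -Complex.I * A .left (evenPoint γ)) (fun γ => A .right (evenPoint γ)) := by
  have hr : ((√(1 - δ ^ 2) : ℝ) : ℂ) ≠ 0 := by exact_mod_cast (sqrt_even_pos h0 h1).ne'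
  have hs : ((√(1 + m ^ 2 * ε ^ 2) : ℝ) : ℂ) ≠ 0 := by exact_mod_cast (sqrt_odd_pos m ε).ne'
  refine ⟨fun n j => ?_, fun n j => ?_⟩
  · have he := isEven_evenPoint (n, j + 1)
    have ho := hasParity_int.not_isEven_prev he .left
    have h2 := h.even_left _ he
    rw [h.odd_left _ ho, h.odd_right _ ho, evenPoint_prev_left_prev_left,
      evenPoint_prev_left_prev_right] at h2
    rw [h2, stepNorm]
    push_cast
    simp only [sub_neg_eq_add]
    field_simp
    linear_combination δ * A .right (evenPoint (n + 1, j)) * Complex.I_sq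
  · have he := isEven_evenPoint (n, j + 1)
    have ho := hasParity_int.not_isEven_prev he .right
    have h2 := h.even_right _ he
    rw [h.odd_left _ ho, h.odd_right _ ho, evenPoint_prev_right_prev_left,
      evenPoint_prev_right_prev_right, ite_two_eq_unitSource] at h2
    rw [h2, stepNorm]
    push_cast
    simp only [← sub_eq_add_neg]
    field_simp
    linear_combination (-m * ε) * A .left (evenPoint (n, j)) * Complex.I_sq

theorem SatisfiesAxioms.summable (h : SatisfiesAxioms m ε δ A) (k : Dir) :
    Summable fun γ => ‖A k (evenPoint γ)‖ ^ 2 := by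
  refine Summable.of_nonneg_of_le (fun _ => sq_nonneg _) (fun γ => ?_) h.square_summable
  have e : evenSite ℤ γ.1 γ.2 = evenPoint γ := by simp [evenSite_eq_evenPoint]
  rw [e]
  cases k
  · exact le_add_of_nonneg_right (sq_nonneg _)
  · exact le_add_of_nonneg_left (sq_nonneg _)

theorem SatisfiesAxioms.eq_solution (h : SatisfiesAxioms m ε δ A) (hμ : 0 < m * ε) (h0 : 0 < δ)
    (h1 : δ < 1) (γ : ℤ × ℤ) :
    A .left (evenPoint γ) = Complex.I * solutionFst m ε (-1) 2 δ γ ∧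
      A .right (evenPoint γ) = solutionSnd m ε 2 δ γ := by
  have hu := (h.isEvolution h0 h1).unique (isEvolution_solution hμ h0 h1 (Or.inr rfl) 2)
    (stepNorm_sq h0 h1) (stepNorm_pos h0 h1).ne' (Or.inr rfl) (mul_pos hμ h0)
    ((h.summable .left).congr fun γ => by simp) (h.summable .right)
    (summable_solutionFst hμ h0 h1 _ _) (summable_solutionSnd hμ h0 h1 _)
  refine ⟨?_, congrFun hu.2 γ⟩
  rw [← congrFun hu.1 γ]
  linear_combination A .left (evenPoint γ) * Complex.I_sq

/-- Square-summability determines the even points; the axioms at odd points then determine the rest.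
-/
theorem SatisfiesAxioms.unique {A' : Dir → Site ℤ → ℂ} (h : SatisfiesAxioms m ε δ A)
    (h' : SatisfiesAxioms m ε δ A') (hμ : 0 < m * ε) (h0 : 0 < δ) (h1 : δ < 1) : A = A' := by
  have heven : ∀ k (p : Site ℤ), p.IsEven → A k p = A' k p := by
    intro k p hp
    obtain ⟨γ, rfl⟩ := hp.exists_eq
    have e := h.eq_solution hμ h0 h1 γ
    have e' := h'.eq_solution hμ h0 h1 γ
    cases k
    · rw [e.1, e'.1]
    · rw [e.2, e'.2]
  funext k p
  by_cases hp : p.IsEven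
  · exact heven k p hp
  · have hpr := fun d => hasParity_int.isEven_prev hp d
    cases k
    · rw [h.odd_left p hp, h'.odd_left p hp, heven _ _ (hpr _), heven _ _ (hpr _)]
    · rw [h.odd_right p hp, h'.odd_right p hp, heven _ _ (hpr _), heven _ _ (hpr _)]

/-- Half of the coordinates of a point. -/
def Site.half (p : Site ℤ) : ℤ × ℤ := (p.1.1 / 2, p.1.2 / 2)

theorem half_evenPoint (γ : ℤ × ℤ) : (evenPoint γ).half = γ := by
  simp [Site.half, evenPoint]

open Classical in
/-- The extension of a pair of functions from the even points to all points by the axioms. -/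
noncomputable def extendOdd (δ : ℝ) (u v : ℤ × ℤ → ℂ) : Dir → Site ℤ → ℂ
  | .left, p => if p.IsEven then Complex.I * u p.half else
      1 / (√(1 - δ ^ 2) : ℂ) * (Complex.I * u (p.prev .left).half -
        Complex.I * δ * v (p.prev .left).half)
  | .right, p => if p.IsEven then v p.half else
      1 / (√(1 - δ ^ 2) : ℂ) * (v (p.prev .right).half +
        Complex.I * δ * (Complex.I * u (p.prev .right).half))

theorem IsEvolution.satisfiesAxioms {u v : ℤ × ℤ → ℂ}
    (h : IsEvolution (stepNorm m ε δ) (m * ε) δ (-1 : ℤ) (fun γ => 2 * unitSource ℤ γ) u v)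
    (h0 : 0 < δ) (h1 : δ < 1)
    (hu : Summable fun γ => ‖u γ‖ ^ 2) (hv : Summable fun γ => ‖v γ‖ ^ 2) :
    SatisfiesAxioms m ε δ (extendOdd δ u v) := by
  have hr : ((√(1 - δ ^ 2) : ℝ) : ℂ) ≠ 0 := by exact_mod_cast (sqrt_even_pos h0 h1).ne'
  have hs : ((√(1 + m ^ 2 * ε ^ 2) : ℝ) : ℂ) ≠ 0 := by exact_mod_cast (sqrt_odd_pos m ε).ne'
  have hel : ∀ p : Site ℤ, p.IsEven → extendOdd δ u v .left p = Complex.I * u p.half :=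
    fun p hp => if_pos hp
  have her : ∀ p : Site ℤ, p.IsEven → extendOdd δ u v .right p = v p.half := fun p hp => if_pos hp
  have hol : ∀ p : Site ℤ, ¬ p.IsEven → extendOdd δ u v .left p = 1 / (√(1 - δ ^ 2) : ℂ) *
      (Complex.I * u (p.prev .left).half - Complex.I * δ * v (p.prev .left).half) :=
    fun p hp => if_neg hp
  have hor : ∀ p : Site ℤ, ¬ p.IsEven → extendOdd δ u v .right p = 1 / (√(1 - δ ^ 2) : ℂ) *
      (v (p.prev .right).half + Complex.I * δ * (Complex.I * u (p.prev .right).half)) :=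
    fun p hp => if_neg hp
  refine ⟨fun p hp => ?_, fun p hp => ?_, fun p hp => ?_, fun p hp => ?_, ?_⟩
  · obtain ⟨⟨n, j⟩, rfl⟩ := hp.exists_eq
    obtain ⟨j, rfl⟩ : ∃ j', j = j' + 1 := ⟨j - 1, by ring⟩
    have ho := hasParity_int.not_isEven_prev hp .left
    have h2 := h.fst n j
    rw [hel _ hp, hol _ ho, hor _ ho, evenPoint_prev_left_prev_left,
      evenPoint_prev_left_prev_right, half_evenPoint, half_evenPoint, half_evenPoint]
    rw [stepNorm] at h2
    push_cast at h2
    simp only [sub_neg_eq_add] at h2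
    field_simp
    linear_combination Complex.I * h2 - m * ε * v (n, j) * Complex.I_sq
  · obtain ⟨⟨n, j⟩, rfl⟩ := hp.exists_eq
    obtain ⟨j, rfl⟩ : ∃ j', j = j' + 1 := ⟨j - 1, by ring⟩
    have ho := hasParity_int.not_isEven_prev hp .right
    have h2 := h.snd n j
    rw [her _ hp, hol _ ho, hor _ ho, evenPoint_prev_right_prev_left,
      evenPoint_prev_right_prev_right, half_evenPoint, half_evenPoint, half_evenPoint,
      ite_two_eq_unitSource]
    rw [stepNorm] at h2
    push_cast at h2
    simp only [← sub_eq_add_neg] at h2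
    field_simp
    linear_combination h2 - δ * u (n - 1, j) * Complex.I_sq
  · have hpr := hasParity_int.isEven_prev hp .left
    rw [hol p hp, hel _ hpr, her _ hpr]
  · have hpr := hasParity_int.isEven_prev hp .right
    rw [hor p hp, hel _ hpr, her _ hpr]
  · refine (hu.add hv).congr fun γ => ?_
    have e : evenSite ℤ γ.1 γ.2 = evenPoint γ := by simp [evenSite_eq_evenPoint]
    rw [e, hel _ (isEven_evenPoint γ), her _ (isEven_evenPoint γ), half_evenPoint]
    simp

theorem existsUnique_satisfiesAxioms (hμ : 0 < m * ε) (h0 : 0 < δ) (h1 : δ < 1) :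
    ∃! A : Dir → Site ℤ → ℂ, SatisfiesAxioms m ε δ A :=
  ⟨_, (isEvolution_solution hμ h0 h1 (Or.inr rfl) 2).satisfiesAxioms h0 h1
    (summable_solutionFst hμ h0 h1 _ _) (summable_solutionSnd hμ h0 h1 _),
    fun _ hA => hA.unique ((isEvolution_solution hμ h0 h1 (Or.inr rfl) 2).satisfiesAxioms h0 h1
      (summable_solutionFst hμ h0 h1 _ _) (summable_solutionSnd hμ h0 h1 _)) hμ h0 h1⟩

theorem axiomaticPropagator_eq (hμ : 0 < m * ε) (h0 : 0 < δ) (h1 : δ < 1) (γ : ℤ × ℤ) :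
    axiomaticPropagator m ε δ .left (evenPoint γ) = Complex.I * solutionFst m ε (-1) 2 δ γ ∧
      axiomaticPropagator m ε δ .right (evenPoint γ) = solutionSnd m ε 2 δ γ :=
  (Classical.epsilon_spec (existsUnique_satisfiesAxioms hμ h0 h1).exists :
    SatisfiesAxioms m ε δ (axiomaticPropagator m ε δ)).eq_solution hμ h0 h1 γ

/-- The value of the lattice propagator. -/
noncomputable def latticeValue (m ε : ℝ) : Dir → ℤ × ℤ → ℂ
  | .left, γ => 2 * Complex.I * solutionFst m ε 1 1 0 γ
  | .right, γ => 2 * solutionSnd m ε 1 0 γ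

theorem tendsto_axiomaticPropagator (hμ : 0 < m * ε) (k : Dir) (γ : ℤ × ℤ) :
    Tendsto (fun δ => axiomaticPropagator m ε δ k (evenPoint γ)) (𝓝[>] 0)
      (𝓝 (latticeValue m ε k γ)) := by
  cases k
  · have h := (tendsto_solutionFst hμ (-1) 2 γ).const_mul Complex.I
    rw [solutionFst_zero (-1) 1, ← mul_assoc, mul_comm Complex.I] at h
    refine h.congr' ?_
    filter_upwards [Ioo_mem_nhdsGT (zero_lt_one (α := ℝ))] with δ hδ
    exact (axiomaticPropagator_eq hμ hδ.1 hδ.2 γ).1.symm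
  · have h := tendsto_solutionSnd hμ 2 γ
    rw [solutionSnd_smul] at h
    refine h.congr' ?_
    filter_upwards [Ioo_mem_nhdsGT (zero_lt_one (α := ℝ))] with δ hδ
    exact (axiomaticPropagator_eq hμ hδ.1 hδ.2 γ).2.symm

theorem tendsto_finitePropagator (hμ : 0 < m * ε) (h0 : 0 < δ) (h1 : δ < 1) (n j : ℤ) :
    Tendsto (fun T : ℕ+ => finitePropagator m ε δ (sourceEdge (T : ℕ)) (sinkEdge (T : ℕ) .left n j))
      atTop (𝓝 (solutionFst m ε 1 1 δ (n, j))) ∧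
    Tendsto (fun T : ℕ+ => finitePropagator m ε δ (sourceEdge (T : ℕ)) (sinkEdge (T : ℕ) .right n j))
      atTop (𝓝 (solutionSnd m ε 1 δ (n, j))) := by
  have h := isEvolution_solution hμ h0 h1 (Or.inl rfl) 1
  simp only [one_mul] at h
  exact tendsto_liftedPropagator hμ h0 h1 h (summable_solutionFst hμ h0 h1 _ _)
    (summable_solutionSnd hμ h0 h1 _) (n, j)

end Axioms

end FeynmanAnticheckers

/-! ### Assembly of the theorem. -/

open FeynmanAnticheckers
theorem mainTheorem5 (m ε : ℝ) (hm : 0 < m) (hε : 0 < ε) :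
    -- the denominator of the finite-lattice propagator is nonzero
    (∀ (T : ℕ+) (δ : ℝ), 0 < δ → δ < 1 → loopSum (T : ℕ) m ε δ ≠ 0) ∧
    -- the axioms define a unique pair of functions
    (∀ δ : ℝ, 0 < δ → δ < 1 → ∃! A : Dir → Site ℤ → ℂ, SatisfiesAxioms m ε δ A) ∧
    ∀ (k : Dir) (n j : ℤ),
      -- the limit defining the lattice propagator exists
      Tendsto (fun δ : ℝ => axiomaticPropagator m ε δ k (evenSite ℤ n j)) (𝓝[>] 0)
        (𝓝 (latticePropagator m ε k n j)) ∧
      -- the iterated limit exists and equals the lattice propagator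
      ∃ B : ℝ → ℂ,
        (∀ δ : ℝ, 0 < δ → δ < 1 →
          Tendsto
            (fun T : ℕ+ => finitePropagator m ε δ (sourceEdge (T : ℕ)) (sinkEdge (T : ℕ) k n j))
            atTop (𝓝 (B δ))) ∧
        Tendsto (fun δ : ℝ => -2 * (-Complex.I) ^ k.index * B δ) (𝓝[>] 0)
          (𝓝 (latticePropagator m ε k n j)) := by
  have hμ : 0 < m * ε := mul_pos hm hε
  refine ⟨fun T δ h0 h1 => loopSum_ne_zero hμ h0 h1,
    fun δ h0 h1 => existsUnique_satisfiesAxioms hμ h0 h1, fun k n j => ?_⟩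
  have hA : Tendsto (fun δ : ℝ => axiomaticPropagator m ε δ k (evenSite ℤ n j)) (𝓝[>] 0)
      (𝓝 (latticeValue m ε k (n, j))) := tendsto_axiomaticPropagator hμ k (n, j)
  have hL : latticePropagator m ε k n j = latticeValue m ε k (n, j) := hA.limUnder_eq
  rw [hL]
  refine ⟨hA, ?_⟩
  cases k
  -- For $k=1$ the factor is $-2(-i)=2i$: the doubled source times the $i$ that undoes $-iA_1$. For
  -- $k=2$ it is $-2(-i)^2=2$.
  · refine ⟨fun δ => solutionFst m ε 1 1 δ (n, j),
      fun δ h0 h1 => (tendsto_finitePropagator hμ h0 h1 n j).1, ?_⟩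
    have h := (tendsto_solutionFst hμ 1 1 (n, j)).const_mul (-2 * (-Complex.I) ^ Dir.left.index)
    have e : -2 * (-Complex.I) ^ Dir.left.index * solutionFst m ε 1 1 0 (n, j) =
        latticeValue m ε .left (n, j) := by
      simp only [Dir.index, latticeValue]
      ring
    rwa [e] at h
  · refine ⟨fun δ => solutionSnd m ε 1 δ (n, j),
      fun δ h0 h1 => (tendsto_finitePropagator hμ h0 h1 n j).2, ?_⟩
    have h := (tendsto_solutionSnd hμ 1 (n, j)).const_mul (-2 * (-Complex.I) ^ Dir.right.index)
    have e : -2 * (-Complex.I) ^ Dir.right.index * solutionSnd m ε 1 0 (n, j) =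
        latticeValue m ε .right (n, j) := by
      simp only [Dir.index, latticeValue]
      linear_combination (-2) * solutionSnd m ε 1 0 (n, j) * Complex.I_sq
    rwa [e] at h
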